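/- Let $\mathcal K$ be a tensor triangulated category: a triangulated category with a symmetric monoidal structure $(\otimes,\mathbb 1)$ that is exact in each variable and compatible with the suspension $\Sigma$ in the usual way (natural isomorphisms $\Sigma^m X\otimes Y\cong\Sigma^m(X\otimes Y)\cong X\otimes\Sigma^m Y$, compatible with the associativity, unit and symmetry isomorphisms, the two identifications $\Sigma^mX\otimes\Sigma^nY\cong\Sigma^{m+n}(X\otimes Y)$ differing by the sign $(-1)^{mn}$). Let $\mathrm{Spc}(\mathcal K)$ be the set of prime ideals of $\mathcal K$ (proper thick $\otimes$-ideals $\mathcal P$ such that $a\otimes b\in\mathcal P$ implies $a\in\mathcal P$ or $b\in\mathcal P$) with the topology whose closed subsets are the sets $\{\mathcal P : S\cap\mathcal P=\emptyset\}$ for collections of objects $S$, and put $\mathrm{supp}(a)=\{\mathcal P: a\notin\mathcal P\}$. For an object $X$ let $E_X$ be the ring of those endomorphisms $f$ of $X$ with $f\otimes X=X\otimes f$, and let $E_X^\bullet$ be the $\mathbb Z$-graded ring of those graded endomorphisms $f$ of $X$ (morphisms from $X$ to suspensions of $X$) with $f\otimes X=X\otimes f$. Let $\Phi$ be a non-empty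 set of objects that is closed under $\otimes$, and put $\mathcal Z_\Phi=\bigcap_{X\in\Phi}\mathrm{supp}(X)\subseteq\mathrm{Spc}(\mathcal K)$ with the subspace topology. Let $R_\Phi$ be the commutative ring of classes $[f]$ of $f\in E_X$, $X\in\Phi$, under the smallest equivalence relation with $f\sim a\otimes f$ and $f\sim f\otimes a$ for all $a\in\Phi$, with $[f]+[g]=[f\otimes Y+X\otimes g]$ and $[f][g]=[(f\otimes Y)\circ(X\otimes g)]$ for $f\in E_X$, $g\in E_Y$. Let $R_\Phi^\bullet$ be the $\mathbb Z$-graded ring obtained in the same way, degree by degree, from the $E_X^\bullet$. Let $\mathrm{Spec}^h(R_\Phi^\bullet)$ be the space of its homogeneous prime ideals with the Zariski topology. Then the formulas $$\rho_\Phi(\mathcal P)=\{[f]\in R_\Phi : \mathrm{cone}(f)\notin\mathcal P\},\qquad \rho_\Phi^\bullet(\mathcal P)=\{[f]\in R_\Phi^\bullet\text{ homogeneous} : \mathrm{cone}(f)\notin\mathcal P\}$$ define maps $\rho_\Phi:\mathcal Z_\Phi\to\mathrm{Spec}(R_\Phi)$ and $\rho_\Phi^\bullet:\mathcal Z_\Phi\to\mathrm{Spec}^h(R_\Phi^\bullet)$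 (where the second formula lists the homogeneous elements of the homogeneous prime), and: 1. The preimage under $\rho_\Phi$ of any proper closed subset of $\mathrm{Spec}(R_\Phi)$ is a proper subset of $\mathcal Z_\Phi$, and the preimage under $\rho_\Phi^\bullet$ of any proper closed subset of $\mathrm{Spec}^h(R_\Phi^\bullet)$ is a proper subset of $\mathcal Z_\Phi$. 2. The maps $\rho_\Phi$ and $\rho_\Phi^\bullet$ have dense images. 3. If $\mathcal Z_\Phi$ is irreducible, then $\mathrm{Spec}(R_\Phi)$ and $\mathrm{Spec}^h(R_\Phi^\bullet)$ are irreducible. 4. Balmer's map $\rho_{\mathbb 1}:\mathrm{Spc}(\mathcal K)\to\mathrm{Spec}(\mathrm{End}_{\mathcal K}(\mathbb 1))$, $\rho_{\mathbb 1}(\mathcal P)=\{f:\mathbb 1\to\mathbb 1 : \mathrm{cone}(f)\notin\mathcal P\}$, is well defined and has dense image. -/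

import Mathlib

open CategoryTheory MonoidalCategory Limits Pretriangulated

universe v u

namespace TTG

/-- A tensor triangulated category: a triangulated category with a symmetric monoidal structure
whose tensor product is exact in each variable, together with natural suspension isomorphisms
`X⟦n⟧ ⊗ Y ≅ (X ⊗ Y)⟦n⟧` and `X ⊗ Y⟦n⟧ ≅ (X ⊗ Y)⟦n⟧`. The two ways of identifying `X⟦m⟧ ⊗ Y⟦n⟧`
with `(X ⊗ Y)⟦m + n⟧` differ by the sign `(-1) ^ (m * n)` (this is part of `CommShift₂Int`), and the
suspension isomorphisms are compatible with the braiding, the unitors and the associator. -/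
class TensorTriangulated (K : Type u) [Category.{v} K] [HasZeroObject K] [HasShift K ℤ]
    [Preadditive K] [∀ n : ℤ, (shiftFunctor K n).Additive] [Pretriangulated K]
    [IsTriangulated K] [MonoidalCategory K] [SymmetricCategory K] where
  /-- the suspension isomorphisms -/
  commShift : (curriedTensor K).CommShift₂Int
  tensorLeft_exact (X : K) : (tensorLeft X).IsTriangulated
  tensorRight_exact (X : K) : (tensorRight X).IsTriangulated
  braiding_shift (X Y : K) (n : ℤ) :
    ((tensorRight Y).commShiftIso n).hom.app X ≫ (β_ X Y).hom⟦n⟧' =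
      (β_ (X⟦n⟧) Y).hom ≫ ((tensorLeft Y).commShiftIso n).hom.app X
  leftUnitor_shift (X : K) (n : ℤ) :
    ((tensorLeft (𝟙_ K)).commShiftIso n).hom.app X ≫ (λ_ X).hom⟦n⟧' = (λ_ (X⟦n⟧)).hom
  rightUnitor_shift (X : K) (n : ℤ) :
    ((tensorRight (𝟙_ K)).commShiftIso n).hom.app X ≫ (ρ_ X).hom⟦n⟧' = (ρ_ (X⟦n⟧)).hom
  associator_shift_left (X Y Z : K) (n : ℤ) :
    ((tensorRight Y).commShiftIso n).hom.app X ▷ Z ≫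
        ((tensorRight Z).commShiftIso n).hom.app (X ⊗ Y) ≫ (α_ X Y Z).hom⟦n⟧' =
      (α_ (X⟦n⟧) Y Z).hom ≫ ((tensorRight (Y ⊗ Z)).commShiftIso n).hom.app X
  associator_shift_middle (X Y Z : K) (n : ℤ) :
    ((tensorLeft X).commShiftIso n).hom.app Y ▷ Z ≫
        ((tensorRight Z).commShiftIso n).hom.app (X ⊗ Y) ≫ (α_ X Y Z).hom⟦n⟧' =
      (α_ X (Y⟦n⟧) Z).hom ≫ X ◁ ((tensorRight Z).commShiftIso n).hom.app Y ≫
        ((tensorLeft X).commShiftIso n).hom.app (Y ⊗ Z)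
  associator_shift_right (X Y Z : K) (n : ℤ) :
    ((tensorLeft (X ⊗ Y)).commShiftIso n).hom.app Z ≫ (α_ X Y Z).hom⟦n⟧' =
      (α_ X Y (Z⟦n⟧)).hom ≫ X ◁ ((tensorLeft Y).commShiftIso n).hom.app Z ≫
        ((tensorLeft X).commShiftIso n).hom.app (Y ⊗ Z)

attribute [reducible] TensorTriangulated.commShift

attribute [instance] TensorTriangulated.commShift TensorTriangulated.tensorLeft_exact
  TensorTriangulated.tensorRight_exact

/-! ### The spectrum -/

section Spectrum

variable (K : Type u) [Category.{v} K] [HasZeroObject K] [HasShift K ℤ]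
    [Preadditive K] [∀ n : ℤ, (shiftFunctor K n).Additive] [Pretriangulated K]
    [MonoidalCategory K]

/-- A prime of a tensor triangulated category: a proper thick tensor ideal `P` such that
`a ⊗ b ∈ P` implies `a ∈ P` or `b ∈ P`. Thick means: a triangulated subcategory that is closed
under retracts (in particular under isomorphisms). -/
@[ext]
structure Spc where
  /-- the objects of the prime -/
  mem : ObjectProperty K
  isTriangulated : mem.IsTriangulated
  isStableUnderRetracts : mem.IsStableUnderRetracts
  tensor_left (a : K) {b : K} : mem b → mem (a ⊗ b)
  tensor_right {a : K} (b : K) : mem a → mem (a ⊗ b)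
  exists_notMem : ∃ a, ¬ mem a
  mem_or_mem {a b : K} : mem (a ⊗ b) → mem a ∨ mem b

variable {K}

/-- The support `supp(a) = {P | a ∉ P}`. -/
def supp (a : K) : Set (Spc K) := {P | ¬ P.mem a}

/-- `Z(S) = {P | S ∩ P = ∅}`, for a collection of objects `S`. -/
def Spc.zeroLocus (S : Set K) : Set (Spc K) := {P | ∀ a ∈ S, ¬ P.mem a}

lemma Spc.mem_biprod_iff (P : Spc K) (a b : K) : P.mem (a ⊞ b) ↔ P.mem a ∧ P.mem b := by
  have := P.isTriangulated
  have := P.isStableUnderRetracts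
  constructor
  · intro h
    exact ⟨P.mem.prop_of_retract ⟨biprod.inl, biprod.fst, by simp⟩ h,
      P.mem.prop_of_retract ⟨biprod.inr, biprod.snd, by simp⟩ h⟩
  · rintro ⟨ha, hb⟩
    exact P.mem.ext_of_isTriangulatedClosed₂ _ (binaryBiproductTriangle_distinguished a b) ha hb

/-- The Balmer topology: the closed subsets are the `Z(S)`. -/
instance : TopologicalSpace (Spc K) :=
  TopologicalSpace.ofClosed (Set.range Spc.zeroLocus)
    ⟨Set.univ, by
      ext P
      have := P.isTriangulated
      have := P.isStableUnderRetracts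
      obtain ⟨Z, hZ, hPZ⟩ := P.mem.exists_prop_of_containsZero
      simpa [Spc.zeroLocus] using ⟨Z, hPZ⟩⟩
    (by
      intro A hA
      have hA' : ∀ W ∈ A, ∃ S, Spc.zeroLocus S = W := fun W hW => hA hW
      choose! S hS using hA'
      refine ⟨⋃ W ∈ A, S W, ?_⟩
      ext P
      simp only [Spc.zeroLocus, Set.mem_iUnion, Set.mem_ofPred_eq, Set.mem_sInter]
      constructor
      · intro h W hW
        rw [← hS W hW]
        exact fun a ha => h a ⟨W, hW, ha⟩
      · rintro h a ⟨W, hW, ha⟩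
        have := h W hW
        rw [← hS W hW] at this
        exact this a ha)
    (by
      rintro _ ⟨S, rfl⟩ _ ⟨T, rfl⟩
      refine ⟨Set.image2 (fun a b => a ⊞ b) S T, ?_⟩
      ext P
      simp only [Spc.zeroLocus, Set.mem_ofPred_eq, Set.mem_union, Set.forall_mem_image2,
        Spc.mem_biprod_iff]
      constructor
      · intro h
        by_contra! hc
        obtain ⟨⟨a, ha, ha'⟩, ⟨b, hb, hb'⟩⟩ := hc
        exact h a ha b hb ⟨ha', hb'⟩
      · rintro (h | h) a ha b hb ⟨ha', hb'⟩
        exacts [h a ha ha', h b hb hb'])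

/-- The cone of a morphism: the third object of a chosen distinguished triangle (it is unique up to
isomorphism). -/
noncomputable def cone {X Y : K} (f : X ⟶ Y) : K := (distinguished_cocone_triangle f).choose

end Spectrum

/-! ### Filtered colimits over a tensor-multiplicative set of objects -/

section Colimit

variable (K : Type u) [Category.{v} K] [MonoidalCategory K]

/-- A non-empty set of objects that is closed under the tensor product. -/
structure TensorMultSet where
  carrier : Set K
  nonempty : carrier.Nonempty
  tensor_mem {a b : K} : a ∈ carrier → b ∈ carrier → a ⊗ b ∈ carrier

/-- A family of sets `E X` indexed by the objects `X`, with maps `a ⊗ - : E X → E (a ⊗ X)` and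
`- ⊗ a : E X → E (X ⊗ a)` and with transport along isomorphisms, which behaves as
tensor-balanced endomorphisms do. This is used to treat tensor-balanced endomorphisms and
tensor-balanced graded endomorphisms at the same time. -/
structure BalancedSystem [SymmetricCategory K] where
  obj : K → Type v
  left (a : K) {X : K} : obj X → obj (a ⊗ X)
  right (a : K) {X : K} : obj X → obj (X ⊗ a)
  conj {X Y : K} (e : X ≅ Y) : obj X → obj Y
  balanced {X : K} (f : obj X) : right X f = left X f
  conj_symm {X Y : K} (e : X ≅ Y) (f : obj X) : conj e.symm (conj e f) = f
  conj_left (a : K) {X Y : K} (e : X ≅ Y) (f : obj X) :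
    conj (whiskerLeftIso a e) (left a f) = left a (conj e f)
  conj_whisker {a b : K} (e : a ≅ b) {X : K} (f : obj X) :
    conj (whiskerLeftIso X e) (right a f) = right b f
  left_tensor (a b : K) {X : K} (f : obj X) :
    conj (α_ a b X) (left (a ⊗ b) f) = left a (left b f)
  right_tensor (a b : K) {X : K} (f : obj X) :
    conj (α_ X a b) (right b (right a f)) = right (a ⊗ b) f
  right_left (a b : K) {X : K} (f : obj X) :
    conj (α_ a X b) (right b (left a f)) = left a (right b f)
  braid (a : K) {X : K} (f : obj X) : conj (β_ X a) (right a f) = left a f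
  braid' (a : K) {X : K} (f : obj X) : conj (β_ a X) (left a f) = right a f

variable {K}
variable [SymmetricCategory K] (Φ : TensorMultSet K)

namespace BalancedSystem

/-- The identifications `(X, f) ∼ (a ⊗ X, a ⊗ f)` and `(X, f) ∼ (X ⊗ a, f ⊗ a)`, for `X, a ∈ Φ`. -/
inductive Rel (S : BalancedSystem K) :
    (Σ X : Φ.carrier, S.obj X) → (Σ X : Φ.carrier, S.obj X) → Prop
  | left (a X : Φ.carrier) (f : S.obj X) :
      Rel S ⟨X, f⟩ ⟨⟨a.1 ⊗ X.1, Φ.tensor_mem a.2 X.2⟩, S.left a.1 f⟩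
  | right (a X : Φ.carrier) (f : S.obj X) :
      Rel S ⟨X, f⟩ ⟨⟨X.1 ⊗ a.1, Φ.tensor_mem X.2 a.2⟩, S.right a.1 f⟩

/-- The set of pairs `(X, f)` with `X ∈ Φ` and `f ∈ E X` modulo the smallest equivalence relation
such that `(X, f) ∼ (a ⊗ X, a ⊗ f)` and `(X, f) ∼ (X ⊗ a, f ⊗ a)` for all `a ∈ Φ`. -/
def Colim (S : BalancedSystem K) : Type (max u v) := Quot (S.Rel Φ)

variable {Φ}

/-- The class `[f_X]`. -/
def cls (S : BalancedSystem K) {X : K} (hX : X ∈ Φ.carrier) (f : S.obj X) : S.Colim Φ :=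
  Quot.mk _ ⟨⟨X, hX⟩, f⟩

variable {S T U : BalancedSystem K}

lemma cls_left {a X : K} (ha : a ∈ Φ.carrier) (hX : X ∈ Φ.carrier) (f : S.obj X) :
    S.cls (Φ.tensor_mem ha hX) (S.left a f) = S.cls hX f :=
  (Quot.sound (Rel.left ⟨a, ha⟩ ⟨X, hX⟩ f)).symm

lemma cls_right {a X : K} (ha : a ∈ Φ.carrier) (hX : X ∈ Φ.carrier) (f : S.obj X) :
    S.cls (Φ.tensor_mem hX ha) (S.right a f) = S.cls hX f :=
  (Quot.sound (Rel.right ⟨a, ha⟩ ⟨X, hX⟩ f)).symm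

lemma cls_conj {X Y : K} (hX : X ∈ Φ.carrier) (hY : Y ∈ Φ.carrier) (e : X ≅ Y) (f : S.obj X) :
    S.cls hY (S.conj e f) = S.cls hX f := by
  rw [← cls_left hX hY, ← S.conj_left, ← S.balanced, S.conj_whisker, cls_right hY hX]

lemma cls_eq_of_conj {X Y : K} (hX : X ∈ Φ.carrier) (hY : Y ∈ Φ.carrier) (e : X ≅ Y) {f : S.obj X}
    {g : S.obj Y} (h : S.conj e f = g) : S.cls hX f = S.cls hY g := by
  rw [← h, cls_conj]

lemma Colim.exists_rep (x : S.Colim Φ) :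
    ∃ (X : K) (hX : X ∈ Φ.carrier) (f : S.obj X), S.cls hX f = x := by
  obtain ⟨⟨⟨X, hX⟩, f⟩, rfl⟩ := Quot.exists_rep x
  exact ⟨X, hX, f, rfl⟩

lemma Colim.exists_rep₂ (x : S.Colim Φ) (y : T.Colim Φ) :
    ∃ (X : K) (hX : X ∈ Φ.carrier) (f : S.obj X) (g : T.obj X), S.cls hX f = x ∧ T.cls hX g = y := by
  obtain ⟨X, hX, f, rfl⟩ := x.exists_rep
  obtain ⟨Y, hY, g, rfl⟩ := y.exists_rep
  exact ⟨X ⊗ Y, Φ.tensor_mem hX hY, S.right Y f, T.left X g, cls_right hY hX f, cls_left hX hY g⟩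

lemma Colim.exists_rep₃ (x : S.Colim Φ) (y : T.Colim Φ) (z : U.Colim Φ) :
    ∃ (X : K) (hX : X ∈ Φ.carrier) (f : S.obj X) (g : T.obj X) (h : U.obj X),
      S.cls hX f = x ∧ T.cls hX g = y ∧ U.cls hX h = z := by
  obtain ⟨X, hX, f, g, rfl, rfl⟩ := x.exists_rep₂ y
  obtain ⟨Y, hY, h, rfl⟩ := z.exists_rep
  exact ⟨X ⊗ Y, Φ.tensor_mem hX hY, S.right Y f, T.right Y g, U.left X h,
    cls_right hY hX f, cls_right hY hX g, cls_left hX hY h⟩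

/-- A family of elements `c X ∈ E X` compatible with tensoring. -/
structure Const (S : BalancedSystem K) where
  val (X : K) : S.obj X
  left (a X : K) : S.left a (val X) = val (a ⊗ X)
  right (a X : K) : S.right a (val X) = val (X ⊗ a)

/-- The class of a constant. -/
noncomputable def constClass (c : S.Const) : S.Colim Φ := S.cls Φ.nonempty.some_mem (c.val _)

lemma constClass_eq (c : S.Const) {X : K} (hX : X ∈ Φ.carrier) :
    constClass c = S.cls hX (c.val X) := by
  rw [constClass, ← cls_left hX, c.left, ← c.right, cls_right Φ.nonempty.some_mem hX]

/-- A family of maps `E X → E' X` compatible with tensoring. -/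
structure Op₁ (S T : BalancedSystem K) where
  op {X : K} : S.obj X → T.obj X
  left (a : K) {X : K} (f : S.obj X) : T.left a (op f) = op (S.left a f)
  right (a : K) {X : K} (f : S.obj X) : T.right a (op f) = op (S.right a f)

/-- The map `[f_X] ↦ [op f_X]`. -/
def map (o : Op₁ S T) : S.Colim Φ → T.Colim Φ :=
  Quot.lift (fun p => T.cls p.1.2 (o.op p.2)) (by
    rintro _ _ (⟨a, X, f⟩ | ⟨a, X, f⟩)
    · dsimp only
      rw [← o.left, cls_left a.2]
    · dsimp only
      rw [← o.right, cls_right a.2])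

lemma map_mk (o : Op₁ S T) {X : K} (hX : X ∈ Φ.carrier) (f : S.obj X) :
    map o (S.cls hX f) = T.cls hX (o.op f) := rfl

/-- A family of maps `E X → E' X → E'' X` compatible with tensoring and with isomorphisms. -/
structure Op₂ (S T U : BalancedSystem K) where
  op {X : K} : S.obj X → T.obj X → U.obj X
  left (a : K) {X : K} (f : S.obj X) (g : T.obj X) :
    U.left a (op f g) = op (S.left a f) (T.left a g)
  right (a : K) {X : K} (f : S.obj X) (g : T.obj X) :
    U.right a (op f g) = op (S.right a f) (T.right a g)
  conj {X Y : K} (e : X ≅ Y) (f : S.obj X) (g : T.obj X) :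
    U.conj e (op f g) = op (S.conj e f) (T.conj e g)

lemma op_right (o : Op₂ S T U) {a X Y : K} (ha : a ∈ Φ.carrier) (hX : X ∈ Φ.carrier)
    (hY : Y ∈ Φ.carrier) (f : S.obj X) (g : T.obj Y) :
    U.cls (Φ.tensor_mem hX (Φ.tensor_mem hY ha)) (o.op (S.right (Y ⊗ a) f) (T.left X (T.right a g))) =
      U.cls (Φ.tensor_mem hX hY) (o.op (S.right Y f) (T.left X g)) := by
  rw [← cls_right ha (Φ.tensor_mem hX hY), o.right]
  refine (cls_eq_of_conj _ _ (α_ X Y a) ?_).symm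
  rw [o.conj, S.right_tensor, T.right_left]

lemma op_left (o : Op₂ S T U) {a X Y : K} (ha : a ∈ Φ.carrier) (hX : X ∈ Φ.carrier)
    (hY : Y ∈ Φ.carrier) (f : S.obj X) (g : T.obj Y) :
    U.cls (Φ.tensor_mem hX (Φ.tensor_mem ha hY)) (o.op (S.right (a ⊗ Y) f) (T.left X (T.left a g))) =
      U.cls (Φ.tensor_mem hX hY) (o.op (S.right Y f) (T.left X g)) := by
  rw [← op_right o ha hX hY]
  refine cls_eq_of_conj _ _ (whiskerLeftIso X (β_ a Y)) ?_
  rw [o.conj, S.conj_whisker, T.conj_left, T.braid']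

/-- The map `([f_X], [g_Y]) ↦ [op (f_X ⊗ Y) (X ⊗ g_Y)]`. -/
def map₂ (o : Op₂ S T U) (x : S.Colim Φ) (y : T.Colim Φ) : U.Colim Φ :=
  Quot.lift₂ (fun p q => U.cls (Φ.tensor_mem p.1.2 q.1.2)
      (o.op (S.right q.1.1 p.2) (T.left p.1.1 q.2)))
    (by
      rintro ⟨⟨X, hX⟩, f⟩ _ _ (⟨⟨a, ha⟩, ⟨Y, hY⟩, g⟩ | ⟨⟨a, ha⟩, ⟨Y, hY⟩, g⟩)
      · exact (op_left o ha hX hY f g).symm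
      · exact (op_right o ha hX hY f g).symm)
    (by
      rintro _ _ ⟨⟨Y, hY⟩, g⟩ (⟨⟨a, ha⟩, ⟨X, hX⟩, f⟩ | ⟨⟨a, ha⟩, ⟨X, hX⟩, f⟩)
      · rw [← cls_left ha, o.left]
        refine (cls_eq_of_conj _ _ (α_ a X Y) ?_).symm
        rw [o.conj, S.right_left, T.left_tensor]
      · refine (op_left o ha hX hY f g).symm.trans (cls_eq_of_conj _ _ (α_ X a Y) ?_).symm
        rw [o.conj, S.right_tensor, T.left_tensor]) x y

/-- On classes of elements of the same `E X` the operation can be computed in `E X`. -/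
lemma map₂_mk (o : Op₂ S T U) {X : K} (hX : X ∈ Φ.carrier) (f : S.obj X) (g : T.obj X) :
    map₂ o (S.cls hX f) (T.cls hX g) = U.cls hX (o.op f g) := by
  rw [← cls_right hX hX (o.op f g), o.right, T.balanced]
  rfl

end BalancedSystem

end Colimit

section Endo

variable (K : Type u) [Category.{v} K] [MonoidalCategory K] [SymmetricCategory K]

/-- A family of sets `E X` of (graded) endomorphisms, with tensoring and transport along
isomorphisms. -/
structure EndoSystem where
  obj : K → Type v
  left (a : K) {X : K} : obj X → obj (a ⊗ X)
  right (a : K) {X : K} : obj X → obj (X ⊗ a)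
  conj {X Y : K} (e : X ≅ Y) : obj X → obj Y
  conj_refl {X : K} (f : obj X) : conj (Iso.refl X) f = f
  conj_trans {X Y Z : K} (e : X ≅ Y) (e' : Y ≅ Z) (f : obj X) :
    conj (e ≪≫ e') f = conj e' (conj e f)
  conj_left (a : K) {X Y : K} (e : X ≅ Y) (f : obj X) :
    conj (whiskerLeftIso a e) (left a f) = left a (conj e f)
  conj_right (a : K) {X Y : K} (e : X ≅ Y) (f : obj X) :
    conj (whiskerRightIso e a) (right a f) = right a (conj e f)
  conj_whisker {a b : K} (e : a ≅ b) {X : K} (f : obj X) :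
    conj (whiskerLeftIso X e) (right a f) = right b f
  left_tensor (a b : K) {X : K} (f : obj X) :
    conj (α_ a b X) (left (a ⊗ b) f) = left a (left b f)
  right_tensor (a b : K) {X : K} (f : obj X) :
    conj (α_ X a b) (right b (right a f)) = right (a ⊗ b) f
  right_left (a b : K) {X : K} (f : obj X) :
    conj (α_ a X b) (right b (left a f)) = left a (right b f)
  braid (a : K) {X : K} (f : obj X) : conj (β_ X a) (right a f) = left a f

namespace EndoSystem

variable {K}
variable (S : EndoSystem K)

lemma conj_symm {X Y : K} (e : X ≅ Y) (f : S.obj X) : S.conj e.symm (S.conj e f) = f := by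
  rw [← S.conj_trans, Iso.self_symm_id, S.conj_refl]

lemma conj_eq {X Y : K} {e : X ≅ Y} {f : S.obj X} {g : S.obj Y} (h : S.conj e f = g) :
    S.conj e.symm g = f := by
  rw [← h, conj_symm]

lemma braid' (a : K) {X : K} (f : S.obj X) : S.conj (β_ a X) (S.left a f) = S.right a f := by
  have h : β_ a X = (β_ X a).symm := by
    ext
    simp [SymmetricCategory.braiding_swap_eq_inv_braiding]
  rw [h]
  exact S.conj_eq (S.braid a f)

lemma conj_whisker_left {a b : K} (e : a ≅ b) {X : K} (f : S.obj X) :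
    S.conj (whiskerRightIso e X) (S.left a f) = S.left b f := by
  have h : β_ X a ≪≫ whiskerRightIso e X = whiskerLeftIso X e ≪≫ β_ X b := by
    ext
    simp
  rw [← S.braid, ← S.conj_trans, h, S.conj_trans, S.conj_whisker, S.braid]

lemma conj_balanced {X Y : K} (e : X ≅ Y) (f : S.obj X) (h : S.right X f = S.left X f) :
    S.right Y (S.conj e f) = S.left Y (S.conj e f) := by
  rw [← S.conj_right, ← S.conj_whisker e, h, S.conj_left, S.conj_whisker_left]

lemma right_balanced {X : K} (Y : K) (f : S.obj X) (h : S.right X f = S.left X f) :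
    S.right (X ⊗ Y) (S.right Y f) = S.left (X ⊗ Y) (S.right Y f) := by
  let s : Y ⊗ (X ⊗ Y) ≅ X ⊗ (Y ⊗ Y) :=
    (α_ Y X Y).symm ≪≫ whiskerRightIso (β_ Y X) Y ≪≫ α_ X Y Y
  let e := α_ X Y (X ⊗ Y) ≪≫ whiskerLeftIso X s ≪≫ (α_ X X (Y ⊗ Y)).symm
  have h₁ : S.conj e (S.right (X ⊗ Y) (S.right Y f)) = S.right (Y ⊗ Y) (S.right X f) := by
    simp only [e, S.conj_trans]
    rw [S.right_tensor, S.conj_whisker]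
    exact S.conj_eq (S.right_tensor _ _ _)
  have h₂ : S.conj s (S.left Y (S.right Y f)) = S.right (Y ⊗ Y) f := by
    simp only [s, S.conj_trans]
    rw [S.conj_eq (S.right_left Y Y f), S.conj_right, S.braid', S.right_tensor]
  have h₃ : S.conj e (S.left (X ⊗ Y) (S.right Y f)) = S.right (Y ⊗ Y) (S.left X f) := by
    simp only [e, S.conj_trans]
    rw [S.left_tensor, S.conj_left, h₂]
    exact S.conj_eq (S.right_left _ _ _)
  rw [← S.conj_symm e (S.right (X ⊗ Y) (S.right Y f)), h₁, h, ← h₃, S.conj_symm]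

lemma left_balanced {X : K} (Y : K) (f : S.obj X) (h : S.right X f = S.left X f) :
    S.right (Y ⊗ X) (S.left Y f) = S.left (Y ⊗ X) (S.left Y f) := by
  rw [← S.braid]
  exact S.conj_balanced _ _ (S.right_balanced Y f h)

end EndoSystem

end Endo

section Ungraded

variable {K : Type u} [Category.{v} K] [Preadditive K] [MonoidalCategory K]
  [SymmetricCategory K]

/-- Endomorphisms `f : X ⟶ X`, with `f ↦ a ⊗ f` and `f ↦ f ⊗ a`. -/
def endSystem (K : Type u) [Category.{v} K] [MonoidalCategory K] [SymmetricCategory K] :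
    EndoSystem K where
  obj X := End X
  left a _ f := a ◁ f
  right a _ f := f ▷ a
  conj e f := e.inv ≫ f ≫ e.hom
  conj_refl f := by simp
  conj_trans e e' f := by simp
  conj_left a _ _ e f := by simp
  conj_right a _ _ e f := by simp
  conj_whisker e _ f := by
    have h := whisker_exchange f e.hom
    simp [← h]
  left_tensor a b _ f := by simp
  right_tensor a b _ f := by simp
  right_left a b _ f := by simp
  braid a _ f := by simp

variable [MonoidalPreadditive K]

/-- The ring `E_X` of tensor-balanced endomorphisms of `X`: those `f` with `f ⊗ X = X ⊗ f`. The
multiplication is composition, `f * g = f ∘ g`. -/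
def balancedEnd (X : K) : Subring (End X) where
  carrier := {f | (f : X ⟶ X) ▷ X = X ◁ (f : X ⟶ X)}
  one_mem' := by simp [End.one_def]
  mul_mem' {f g} hf hg := by
    simp only [Set.mem_ofPred_eq, End.mul_def, comp_whiskerRight, whiskerLeft_comp] at *
    rw [hf, hg]
  zero_mem' := by simp
  add_mem' {f g} hf hg := by
    simp only [Set.mem_ofPred_eq] at *
    erw [MonoidalPreadditive.add_whiskerRight, MonoidalPreadditive.whiskerLeft_add, hf, hg]
  neg_mem' {f} hf := by
    simp only [Set.mem_ofPred_eq] at *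
    have h₁ := (tensorLeft X).map_neg (f := (f : X ⟶ X))
    have h₂ := (tensorRight X).map_neg (f := (f : X ⟶ X))
    exact h₂.trans ((congrArg Neg.neg hf).trans h₁.symm)

/-- The rings `E_X` with the maps `a ⊗ - : E_X → E_{a ⊗ X}` and `- ⊗ a : E_X → E_{X ⊗ a}`. -/
def balancedEndSystem (K : Type u) [Category.{v} K] [Preadditive K] [MonoidalCategory K]
    [SymmetricCategory K] [MonoidalPreadditive K] : BalancedSystem K where
  obj X := balancedEnd X
  left a _ f := ⟨a ◁ (f.1 : _ ⟶ _), (endSystem K).left_balanced a f.1 f.2⟩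
  right a _ f := ⟨(f.1 : _ ⟶ _) ▷ a, (endSystem K).right_balanced a f.1 f.2⟩
  conj e f := ⟨e.inv ≫ (f.1 : _ ⟶ _) ≫ e.hom, (endSystem K).conj_balanced e f.1 f.2⟩
  balanced f := Subtype.ext f.2
  conj_symm e f := Subtype.ext ((endSystem K).conj_symm e f.1)
  conj_left a _ _ e f := Subtype.ext ((endSystem K).conj_left a e f.1)
  conj_whisker e _ f := Subtype.ext ((endSystem K).conj_whisker e f.1)
  left_tensor a b _ f := Subtype.ext ((endSystem K).left_tensor a b f.1)
  right_tensor a b _ f := Subtype.ext ((endSystem K).right_tensor a b f.1)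
  right_left a b _ f := Subtype.ext ((endSystem K).right_left a b f.1)
  braid a _ f := Subtype.ext ((endSystem K).braid a f.1)
  braid' a _ f := Subtype.ext ((endSystem K).braid' a f.1)

open BalancedSystem

namespace Ungraded

/-- addition in `E_X` -/
def add : Op₂ (balancedEndSystem K) (balancedEndSystem K) (balancedEndSystem K) where
  op {X} := fun (f g : balancedEnd X) => f + g
  left a _ f g := Subtype.ext (MonoidalPreadditive.whiskerLeft_add _ _)
  right a _ f g := Subtype.ext (MonoidalPreadditive.add_whiskerRight _ _)
  conj e f g := Subtype.ext (by
    change e.inv ≫ (_ + _) ≫ e.hom = (e.inv ≫ _ ≫ e.hom) + (e.inv ≫ _ ≫ e.hom)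
    simp)

/-- multiplication in `E_X` -/
def mul : Op₂ (balancedEndSystem K) (balancedEndSystem K) (balancedEndSystem K) where
  op {X} := fun (f g : balancedEnd X) => f * g
  left a _ f g := Subtype.ext (whiskerLeft_comp _ _ _)
  right a _ f g := Subtype.ext (comp_whiskerRight _ _ _)
  conj e f g := Subtype.ext (by
    change e.inv ≫ (_ ≫ _) ≫ e.hom = (e.inv ≫ _ ≫ e.hom) ≫ (e.inv ≫ _ ≫ e.hom)
    simp)

/-- negation in `E_X` -/
def neg : Op₁ (balancedEndSystem K) (balancedEndSystem K) where
  op {X} := fun (f : balancedEnd X) => ⟨-f.1, neg_mem f.2⟩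
  left a _ f := Subtype.ext ((tensorLeft a).map_neg (f := (f.1 : _ ⟶ _)))
  right a _ f := Subtype.ext ((tensorRight a).map_neg (f := (f.1 : _ ⟶ _)))

/-- zero in `E_X` -/
def zero : Const (balancedEndSystem K) where
  val X := (0 : balancedEnd X)
  left _ _ := Subtype.ext MonoidalPreadditive.whiskerLeft_zero
  right _ _ := Subtype.ext MonoidalPreadditive.zero_whiskerRight

/-- one in `E_X` -/
def one : Const (balancedEndSystem K) where
  val X := (1 : balancedEnd X)
  left _ _ := Subtype.ext (whiskerLeft_id _ _)
  right _ _ := Subtype.ext (id_whiskerRight _ _)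

end Ungraded

/-- The ring `R_Φ`: pairs `(X, f)` with `X ∈ Φ` and `f ∈ E_X`, modulo the smallest equivalence
relation such that `(X, f) ∼ (a ⊗ X, a ⊗ f)` and `(X, f) ∼ (X ⊗ a, f ⊗ a)` for all `a ∈ Φ`. -/
def R (Φ : TensorMultSet K) : Type (max u v) := (balancedEndSystem K).Colim Φ

namespace R

variable {Φ : TensorMultSet K}

/-- The class `[f_X] ∈ R_Φ` of `f ∈ E_X`. -/
def mk {X : K} (hX : X ∈ Φ.carrier) (f : balancedEnd X) : R Φ := (balancedEndSystem K).cls hX f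

/-- `[f_X] + [g_Y] = [f_X ⊗ Y + X ⊗ g_Y]` -/
instance : Add (R Φ) := ⟨map₂ Ungraded.add⟩
/-- `[f_X] * [g_Y] = [(f_X ⊗ Y) ∘ (X ⊗ g_Y)]` -/
instance : Mul (R Φ) := ⟨map₂ Ungraded.mul⟩
instance : Neg (R Φ) := ⟨map Ungraded.neg⟩
noncomputable instance : Zero (R Φ) := ⟨constClass Ungraded.zero⟩
noncomputable instance : One (R Φ) := ⟨constClass Ungraded.one⟩

lemma mk_add {X : K} (hX : X ∈ Φ.carrier) (f g : balancedEnd X) :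
    mk hX f + mk hX g = mk hX (f + g) := map₂_mk Ungraded.add hX f g

lemma mk_mul {X : K} (hX : X ∈ Φ.carrier) (f g : balancedEnd X) :
    mk hX f * mk hX g = mk hX (f * g) := map₂_mk Ungraded.mul hX f g

lemma mk_neg {X : K} (hX : X ∈ Φ.carrier) (f : balancedEnd X) :
    - mk hX f = mk hX (-f) :=
  congrArg (mk hX) (Subtype.ext (NegMemClass.coe_neg f).symm)

lemma zero_eq {X : K} (hX : X ∈ Φ.carrier) : (0 : R Φ) = mk hX 0 :=
  constClass_eq Ungraded.zero hX

lemma one_eq {X : K} (hX : X ∈ Φ.carrier) : (1 : R Φ) = mk hX 1 :=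
  constClass_eq Ungraded.one hX

lemma exists_rep (x : R Φ) : ∃ (X : K) (hX : X ∈ Φ.carrier) (f : balancedEnd X), mk hX f = x :=
  Colim.exists_rep x

lemma exists_rep₂ (x y : R Φ) : ∃ (X : K) (hX : X ∈ Φ.carrier) (f g : balancedEnd X),
    mk hX f = x ∧ mk hX g = y :=
  Colim.exists_rep₂ x y

lemma exists_rep₃ (x y z : R Φ) : ∃ (X : K) (hX : X ∈ Φ.carrier) (f g h : balancedEnd X),
    mk hX f = x ∧ mk hX g = y ∧ mk hX h = z :=
  Colim.exists_rep₃ x y z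

lemma mk_mul_comm {X : K} (hX : X ∈ Φ.carrier) (f g : balancedEnd X) :
    mk hX (f * g) = mk hX (g * f) := by
  have h : (balancedEndSystem K).right X (f * g) = (balancedEndSystem K).right X (g * f) := by
    refine Subtype.ext ?_
    change (g.1 ≫ f.1 : X ⟶ X) ▷ X = (f.1 ≫ g.1 : X ⟶ X) ▷ X
    have hf : (f.1 : X ⟶ X) ▷ X = X ◁ (f.1 : X ⟶ X) := f.2
    rw [comp_whiskerRight, comp_whiskerRight, hf, ← whisker_exchange]
  exact (cls_right hX hX _).symm.trans ((congrArg _ h).trans (cls_right hX hX _))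

noncomputable instance : CommRing (R Φ) where
  add_assoc x y z := by
    obtain ⟨X, hX, f, g, h, rfl, rfl, rfl⟩ := exists_rep₃ x y z
    simp only [mk_add, add_assoc]
  zero_add x := by
    obtain ⟨X, hX, f, rfl⟩ := x.exists_rep
    rw [zero_eq hX, mk_add, zero_add]
  add_zero x := by
    obtain ⟨X, hX, f, rfl⟩ := x.exists_rep
    rw [zero_eq hX, mk_add, add_zero]
  add_comm x y := by
    obtain ⟨X, hX, f, g, rfl, rfl⟩ := exists_rep₂ x y
    simp only [mk_add, add_comm]
  neg_add_cancel x := by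
    obtain ⟨X, hX, f, rfl⟩ := x.exists_rep
    rw [zero_eq hX, mk_neg, mk_add, neg_add_cancel]
  nsmul := nsmulRec
  zsmul := zsmulRec
  left_distrib x y z := by
    obtain ⟨X, hX, f, g, h, rfl, rfl, rfl⟩ := exists_rep₃ x y z
    simp only [mk_add, mk_mul, mul_add]
  right_distrib x y z := by
    obtain ⟨X, hX, f, g, h, rfl, rfl, rfl⟩ := exists_rep₃ x y z
    simp only [mk_add, mk_mul, add_mul]
  zero_mul x := by
    obtain ⟨X, hX, f, rfl⟩ := x.exists_rep
    rw [zero_eq hX, mk_mul, zero_mul]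
  mul_zero x := by
    obtain ⟨X, hX, f, rfl⟩ := x.exists_rep
    rw [zero_eq hX, mk_mul, mul_zero]
  mul_assoc x y z := by
    obtain ⟨X, hX, f, g, h, rfl, rfl, rfl⟩ := exists_rep₃ x y z
    simp only [mk_mul, mul_assoc]
  one_mul x := by
    obtain ⟨X, hX, f, rfl⟩ := x.exists_rep
    rw [one_eq hX, mk_mul, one_mul]
  mul_one x := by
    obtain ⟨X, hX, f, rfl⟩ := x.exists_rep
    rw [one_eq hX, mk_mul, mul_one]
  mul_comm x y := by
    obtain ⟨X, hX, f, g, rfl, rfl⟩ := exists_rep₂ x y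
    rw [mk_mul, mk_mul, mk_mul_comm]

end R

/-- The endomorphism ring of the unit is commutative. -/
instance unitEndCommRing : CommRing (End (𝟙_ K)) where
  mul_comm f g := by
    change (g : 𝟙_ K ⟶ 𝟙_ K) ≫ f = (f : 𝟙_ K ⟶ 𝟙_ K) ≫ g
    have h₁ (f : 𝟙_ K ⟶ 𝟙_ K) : f = (λ_ (𝟙_ K)).inv ≫ 𝟙_ K ◁ f ≫ (λ_ (𝟙_ K)).hom := by simp
    have h₂ (f : 𝟙_ K ⟶ 𝟙_ K) : f = (λ_ (𝟙_ K)).inv ≫ f ▷ 𝟙_ K ≫ (λ_ (𝟙_ K)).hom := by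
      simp [unitors_equal, unitors_inv_equal]
    rw [h₁ f, h₂ g]
    simp only [Category.assoc, Iso.hom_inv_id_assoc]
    rw [whisker_exchange_assoc]

end Ungraded

section Graded

variable {K : Type u} [Category.{v} K] [HasZeroObject K] [HasShift K ℤ]
  [Preadditive K] [∀ n : ℤ, (shiftFunctor K n).Additive] [Pretriangulated K]
  [IsTriangulated K] [MonoidalCategory K] [SymmetricCategory K] [TensorTriangulated K]

instance : MonoidalPreadditive K where
  whiskerLeft_zero {X _ _} := (tensorLeft X).map_zero _ _
  zero_whiskerRight {X _ _} := (tensorRight X).map_zero _ _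
  whiskerLeft_add {X _ _} f g := (tensorLeft X).map_add (f := f) (g := g)
  add_whiskerRight {X _ _} f g := (tensorRight X).map_add (f := f) (g := g)

/-- Graded endomorphisms `f : X ⟶ X⟦i⟧` of degree `i`, with `f ↦ a ⊗ f` and `f ↦ f ⊗ a`
(formed with the help of the suspension isomorphisms). -/
noncomputable def shiftedEndSystem (K : Type u) [Category.{v} K] [HasZeroObject K] [HasShift K ℤ]
    [Preadditive K] [∀ n : ℤ, (shiftFunctor K n).Additive] [Pretriangulated K]
    [IsTriangulated K] [MonoidalCategory K] [SymmetricCategory K] [TensorTriangulated K] (i : ℤ) :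
    EndoSystem K where
  obj X := ShiftedHom X X i
  left a _ f := f.map (tensorLeft a)
  right a _ f := f.map (tensorRight a)
  conj e f := e.inv ≫ f ≫ e.hom⟦i⟧'
  conj_refl f := by simp
  conj_trans e e' f := by simp
  conj_left a X Y e f := by
    have h := ((tensorLeft a).commShiftIso i).hom.naturality e.hom
    simp [ShiftedHom.map] at h ⊢
    rw [h]
  conj_right a X Y e f := by
    have h := ((tensorRight a).commShiftIso i).hom.naturality e.hom
    simp [ShiftedHom.map] at h ⊢
    rw [h]
  conj_whisker {a b} e X f := by
    have h := NatTrans.shift_app_comm ((curriedTensor K).flip.map e.hom) i X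
    have h' := whisker_exchange f e.hom
    simp [ShiftedHom.map] at h ⊢
    rw [h, ← reassoc_of% h']
    simp
  left_tensor a b X f := by
    have h := TensorTriangulated.associator_shift_right a b X i
    simp [ShiftedHom.map] at h ⊢
    simp [h]
  right_tensor a b X f := by
    have h := TensorTriangulated.associator_shift_left X a b i
    simp [ShiftedHom.map] at h ⊢
    simp [h]
  right_left a b X f := by
    have h := TensorTriangulated.associator_shift_middle a X b i
    simp [ShiftedHom.map] at h ⊢
    simp [h]
  braid a X f := by
    have h := TensorTriangulated.braiding_shift X a i
    simp [ShiftedHom.map] at h ⊢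
    simp [h]

/-- The group `E_X^i` of tensor-balanced graded endomorphisms `f : X ⟶ X⟦i⟧` of degree `i`: those
for which `f ⊗ X = X ⊗ f` as morphisms `X ⊗ X ⟶ (X ⊗ X)⟦i⟧`, where the suspension isomorphisms
`X⟦i⟧ ⊗ X ≅ (X ⊗ X)⟦i⟧ ≅ X ⊗ X⟦i⟧` are used. -/
noncomputable def gradedEnd (X : K) (i : ℤ) : AddSubgroup (ShiftedHom X X i) where
  carrier := {f | f.map (tensorRight X) = f.map (tensorLeft X)}
  zero_mem' := by simp
  add_mem' {f g} hf hg := by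
    simp only [Set.mem_ofPred_eq, ShiftedHom.map_add] at *
    rw [hf, hg]
  neg_mem' {f} hf := by
    simp only [Set.mem_ofPred_eq, ShiftedHom.map, Functor.map_neg, Preadditive.neg_comp] at *
    rw [hf]

/-- The groups `E_X^i` with the maps `a ⊗ - : E_X^i → E_{a ⊗ X}^i` and
`- ⊗ a : E_X^i → E_{X ⊗ a}^i`. -/
noncomputable def gradedEndSystem (K : Type u) [Category.{v} K] [HasZeroObject K] [HasShift K ℤ]
    [Preadditive K] [∀ n : ℤ, (shiftFunctor K n).Additive] [Pretriangulated K]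
    [IsTriangulated K] [MonoidalCategory K] [SymmetricCategory K] [TensorTriangulated K] (i : ℤ) :
    BalancedSystem K where
  obj X := gradedEnd X i
  left a _ f := ⟨f.1.map (tensorLeft a), (shiftedEndSystem K i).left_balanced a f.1 f.2⟩
  right a _ f := ⟨f.1.map (tensorRight a), (shiftedEndSystem K i).right_balanced a f.1 f.2⟩
  conj e f := ⟨e.inv ≫ f.1 ≫ e.hom⟦i⟧', (shiftedEndSystem K i).conj_balanced e f.1 f.2⟩
  balanced f := Subtype.ext f.2
  conj_symm e f := Subtype.ext ((shiftedEndSystem K i).conj_symm e f.1)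
  conj_left a _ _ e f := Subtype.ext ((shiftedEndSystem K i).conj_left a e f.1)
  conj_whisker e _ f := Subtype.ext ((shiftedEndSystem K i).conj_whisker e f.1)
  left_tensor a b _ f := Subtype.ext ((shiftedEndSystem K i).left_tensor a b f.1)
  right_tensor a b _ f := Subtype.ext ((shiftedEndSystem K i).right_tensor a b f.1)
  right_left a b _ f := Subtype.ext ((shiftedEndSystem K i).right_left a b f.1)
  braid a _ f := Subtype.ext ((shiftedEndSystem K i).braid a f.1)
  braid' a _ f := Subtype.ext ((shiftedEndSystem K i).braid' a f.1)

/-- The product `f ∘ g` of graded endomorphisms, of degree `k = i + j`: the composite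
`X ⟶ X⟦j⟧ ⟶ X⟦i⟧⟦j⟧ ≅ X⟦k⟧`. -/
noncomputable def gradedEnd.mul {X : K} {i j k : ℤ} (h : i + j = k) (f : gradedEnd X i)
    (g : gradedEnd X j) : gradedEnd X k :=
  ⟨g.1.comp f.1 h, by
    have hf : f.1.map (tensorRight X) = f.1.map (tensorLeft X) := f.2
    have hg : g.1.map (tensorRight X) = g.1.map (tensorLeft X) := g.2
    change (g.1.comp f.1 h).map (tensorRight X) = (g.1.comp f.1 h).map (tensorLeft X)
    rw [ShiftedHom.map_comp, ShiftedHom.map_comp, hf, hg]⟩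

/-- The identity, as a graded endomorphism of degree `0`. -/
noncomputable def gradedEnd.one (X : K) : gradedEnd X 0 :=
  ⟨ShiftedHom.mk₀ 0 rfl (𝟙 X), by
    change (ShiftedHom.mk₀ (0 : ℤ) rfl (𝟙 X)).map (tensorRight X) =
      (ShiftedHom.mk₀ (0 : ℤ) rfl (𝟙 X)).map (tensorLeft X)
    simp⟩

open BalancedSystem

namespace Graded

/-- addition in `E_X^i` -/
noncomputable def add (i : ℤ) :
    Op₂ (gradedEndSystem K i) (gradedEndSystem K i) (gradedEndSystem K i) where
  op {X} := fun (f g : gradedEnd X i) => f + g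
  left a _ f g := Subtype.ext (ShiftedHom.map_add _ _ _)
  right a _ f g := Subtype.ext (ShiftedHom.map_add _ _ _)
  conj e f g := Subtype.ext (by
    change e.inv ≫ (_ + _) ≫ e.hom⟦i⟧' = (e.inv ≫ _ ≫ e.hom⟦i⟧') + (e.inv ≫ _ ≫ e.hom⟦i⟧')
    simp)

/-- the product `E_X^i × E_X^j → E_X^k` for `k = i + j` -/
noncomputable def mul {i j k : ℤ} (h : i + j = k) :
    Op₂ (gradedEndSystem K i) (gradedEndSystem K j) (gradedEndSystem K k) where
  op {X} := fun (f : gradedEnd X i) (g : gradedEnd X j) => gradedEnd.mul h f g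
  left a _ f g := Subtype.ext (ShiftedHom.map_comp _ _ _ _)
  right a _ f g := Subtype.ext (ShiftedHom.map_comp _ _ _ _)
  conj {X Y} e f g := Subtype.ext (by
    change e.inv ≫ (g.1.comp f.1 h) ≫ e.hom⟦k⟧' =
      ShiftedHom.comp (e.inv ≫ g.1 ≫ e.hom⟦j⟧') (e.inv ≫ f.1 ≫ e.hom⟦i⟧') h
    have h' := (shiftFunctorAdd' K i j k h).inv.naturality e.hom
    simp [ShiftedHom.comp] at h' ⊢
    simp [h'])

/-- negation in `E_X^i` -/
noncomputable def neg (i : ℤ) : Op₁ (gradedEndSystem K i) (gradedEndSystem K i) where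
  op {X} := fun (f : gradedEnd X i) => ⟨-f.1, neg_mem f.2⟩
  left a X f := Subtype.ext (by
    change ShiftedHom.map (-f.1) (tensorLeft a) = - (f.1.map (tensorLeft a))
    simp only [ShiftedHom.map, Functor.map_neg, Preadditive.neg_comp])
  right a X f := Subtype.ext (by
    change ShiftedHom.map (-f.1) (tensorRight a) = - (f.1.map (tensorRight a))
    simp only [ShiftedHom.map, Functor.map_neg, Preadditive.neg_comp])

/-- zero in `E_X^i` -/
noncomputable def zero (i : ℤ) : Const (gradedEndSystem K i) where
  val X := (0 : gradedEnd X i)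
  left _ _ := Subtype.ext (ShiftedHom.map_zero _)
  right _ _ := Subtype.ext (ShiftedHom.map_zero _)

/-- one in `E_X^0` -/
noncomputable def one : Const (gradedEndSystem K 0) where
  val X := gradedEnd.one X
  left a X := Subtype.ext ((ShiftedHom.map_mk₀ _ _ _ _).trans (by simp [gradedEnd.one]))
  right a X := Subtype.ext ((ShiftedHom.map_mk₀ _ _ _ _).trans (by simp [gradedEnd.one]))

end Graded

/-- The degree `i` part `R_Φ^i` of the graded ring `R_Φ^•`: pairs `(X, f)` with `X ∈ Φ` and
`f ∈ E_X^i`, modulo the smallest equivalence relation such that `(X, f) ∼ (a ⊗ X, a ⊗ f)` and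
`(X, f) ∼ (X ⊗ a, f ⊗ a)` for all `a ∈ Φ`. -/
noncomputable def GR (Φ : TensorMultSet K) (i : ℤ) : Type (max u v) := (gradedEndSystem K i).Colim Φ

namespace GR

variable {Φ : TensorMultSet K} {i j k : ℤ}

/-- The class `[f_X] ∈ R_Φ^i` of `f ∈ E_X^i`. -/
noncomputable def mk {X : K} (hX : X ∈ Φ.carrier) (f : gradedEnd X i) : GR Φ i :=
  (gradedEndSystem K i).cls hX f

/-- `[f_X] + [g_Y] = [f_X ⊗ Y + X ⊗ g_Y]` -/
noncomputable instance : Add (GR Φ i) := ⟨map₂ (Graded.add i)⟩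
noncomputable instance : Neg (GR Φ i) := ⟨map (Graded.neg i)⟩
noncomputable instance : Zero (GR Φ i) := ⟨constClass (Graded.zero i)⟩

/-- `[f_X] * [g_Y] = [(f_X ⊗ Y) ∘ (X ⊗ g_Y)]` -/
noncomputable def mul (h : i + j = k) : GR Φ i → GR Φ j → GR Φ k := map₂ (Graded.mul h)

/-- The unit of `R_Φ^•`. -/
noncomputable def one : GR Φ 0 := constClass Graded.one

lemma mk_add {X : K} (hX : X ∈ Φ.carrier) (f g : gradedEnd X i) :
    mk hX f + mk hX g = mk hX (f + g) := map₂_mk (Graded.add i) hX f g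

lemma mk_mul (h : i + j = k) {X : K} (hX : X ∈ Φ.carrier) (f : gradedEnd X i)
    (g : gradedEnd X j) : mul h (mk hX f) (mk hX g) = mk hX (gradedEnd.mul h f g) :=
  map₂_mk (Graded.mul h) hX f g

lemma mk_neg {X : K} (hX : X ∈ Φ.carrier) (f : gradedEnd X i) :
    - mk hX f = mk hX (-f) :=
  congrArg (mk hX) (Subtype.ext (NegMemClass.coe_neg f).symm)

lemma zero_eq {X : K} (hX : X ∈ Φ.carrier) : (0 : GR Φ i) = mk hX 0 :=
  constClass_eq (Graded.zero i) hX

lemma one_eq {X : K} (hX : X ∈ Φ.carrier) : (one : GR Φ 0) = mk hX (gradedEnd.one X) :=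
  constClass_eq Graded.one hX

lemma exists_rep (x : GR Φ i) :
    ∃ (X : K) (hX : X ∈ Φ.carrier) (f : gradedEnd X i), mk hX f = x :=
  Colim.exists_rep x

lemma exists_rep₂ (x : GR Φ i) (y : GR Φ j) :
    ∃ (X : K) (hX : X ∈ Φ.carrier) (f : gradedEnd X i) (g : gradedEnd X j),
      mk hX f = x ∧ mk hX g = y :=
  Colim.exists_rep₂ x y

lemma exists_rep₃ (x : GR Φ i) (y : GR Φ j) (z : GR Φ k) :
    ∃ (X : K) (hX : X ∈ Φ.carrier) (f : gradedEnd X i) (g : gradedEnd X j) (h : gradedEnd X k),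
      mk hX f = x ∧ mk hX g = y ∧ mk hX h = z :=
  Colim.exists_rep₃ x y z

noncomputable instance : AddCommGroup (GR Φ i) where
  add_assoc x y z := by
    obtain ⟨X, hX, f, g, h, rfl, rfl, rfl⟩ := exists_rep₃ x y z
    simp only [mk_add, add_assoc]
  zero_add x := by
    obtain ⟨X, hX, f, rfl⟩ := x.exists_rep
    rw [zero_eq hX, mk_add, zero_add]
  add_zero x := by
    obtain ⟨X, hX, f, rfl⟩ := x.exists_rep
    rw [zero_eq hX, mk_add, add_zero]
  add_comm x y := by
    obtain ⟨X, hX, f, g, rfl, rfl⟩ := exists_rep₂ x y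
    simp only [mk_add, add_comm]
  neg_add_cancel x := by
    obtain ⟨X, hX, f, rfl⟩ := x.exists_rep
    rw [zero_eq hX, mk_neg, mk_add, neg_add_cancel]
  nsmul := nsmulRec
  zsmul := zsmulRec

lemma gradedMk_mul {k' : ℤ} (h : i + j = k) (h' : k = k') (x : GR Φ i) (y : GR Φ j) :
    GradedMonoid.mk k (mul h x y) = GradedMonoid.mk k' (mul (h.trans h') x y) := by
  subst h'
  rfl

noncomputable instance : GradedMonoid.GMul (GR Φ) := ⟨mul rfl⟩
noncomputable instance : GradedMonoid.GOne (GR Φ) := ⟨one⟩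

lemma mk_gmul {X : K} (hX : X ∈ Φ.carrier) (f : gradedEnd X i) (g : gradedEnd X j) :
    GradedMonoid.GMul.mul (mk hX f) (mk hX g) = mk hX (gradedEnd.mul rfl f g) :=
  mk_mul rfl hX f g

/-- `R_Φ^•` is a `ℤ`-graded ring. -/
noncomputable instance : DirectSum.GRing (GR Φ) where
  mul_zero {i j} x := by
    obtain ⟨X, hX, f, rfl⟩ := x.exists_rep
    rw [zero_eq hX, mk_gmul, zero_eq hX]
    congr 1
    exact Subtype.ext (ShiftedHom.zero_comp _ _ _ _)
  zero_mul {i j} x := by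
    obtain ⟨X, hX, f, rfl⟩ := x.exists_rep
    rw [zero_eq hX, mk_gmul, zero_eq hX]
    congr 1
    exact Subtype.ext (ShiftedHom.comp_zero _ _ _)
  mul_add x y z := by
    obtain ⟨X, hX, f, g, h, rfl, rfl, rfl⟩ := exists_rep₃ x y z
    rw [mk_gmul, mk_gmul, mk_add, mk_add, mk_gmul]
    congr 1
    exact Subtype.ext (ShiftedHom.add_comp _ _ _ _)
  add_mul x y z := by
    obtain ⟨X, hX, f, g, h, rfl, rfl, rfl⟩ := exists_rep₃ x y z
    rw [mk_gmul, mk_gmul, mk_add, mk_add, mk_gmul]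
    congr 1
    exact Subtype.ext (ShiftedHom.comp_add _ _ _ _)
  one_mul := by
    rintro ⟨i, x⟩
    obtain ⟨X, hX, f, rfl⟩ := x.exists_rep
    change GradedMonoid.mk _ (mul rfl one (mk hX f)) = GradedMonoid.mk i (mk hX f)
    rw [gradedMk_mul rfl (zero_add i), one_eq hX, mk_mul]
    congr 2
    exact Subtype.ext (ShiftedHom.comp_mk₀_id _ _ _)
  mul_one := by
    rintro ⟨i, x⟩
    obtain ⟨X, hX, f, rfl⟩ := x.exists_rep
    change GradedMonoid.mk _ (mul rfl (mk hX f) one) = GradedMonoid.mk i (mk hX f)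
    rw [gradedMk_mul rfl (add_zero i), one_eq hX, mk_mul]
    congr 2
    exact Subtype.ext (ShiftedHom.mk₀_id_comp _ _ _)
  mul_assoc := by
    rintro ⟨i, x⟩ ⟨j, y⟩ ⟨k, z⟩
    obtain ⟨X, hX, f, g, h, rfl, rfl, rfl⟩ := exists_rep₃ x y z
    change GradedMonoid.mk _ (mul rfl (mul rfl (mk hX f) (mk hX g)) (mk hX h)) =
      GradedMonoid.mk _ (mul rfl (mk hX f) (mul rfl (mk hX g) (mk hX h)))
    rw [gradedMk_mul rfl (add_assoc i j k), mk_mul, mk_mul, mk_mul, mk_mul]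
    congr 2
    exact Subtype.ext (ShiftedHom.comp_assoc h.1 g.1 f.1 rfl rfl (add_assoc i j k)).symm
  natCast n := n • one
  natCast_zero := zero_nsmul _
  natCast_succ n := succ_nsmul _ _
  intCast n := n • one
  intCast_ofNat n := natCast_zsmul _ _
  intCast_negSucc_ofNat n := negSucc_zsmul _ _

end GR

end Graded

section HomogeneousSpectrum

variable (A : ℤ → Type u) [∀ i, AddCommGroup (A i)] [DirectSum.GRing A]

/-- The points of the homogeneous spectrum of a `ℤ`-graded ring `A^•`: homogeneous prime ideals. A
homogeneous two-sided ideal is given by its homogeneous parts `𝔭^i ⊆ A^i`, and it is prime if it is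
proper and if `a * b ∈ 𝔭` implies `a ∈ 𝔭` or `b ∈ 𝔭` for all homogeneous elements `a`, `b`. -/
@[ext]
structure HomogSpec where
  /-- the homogeneous parts -/
  part (i : ℤ) : AddSubgroup (A i)
  mul_mem_left {i j : ℤ} (a : A i) {b : A j} :
    b ∈ part j → (GradedMonoid.GMul.mul a b : A (i + j)) ∈ part (i + j)
  mul_mem_right {i j : ℤ} {a : A i} (b : A j) :
    a ∈ part i → (GradedMonoid.GMul.mul a b : A (i + j)) ∈ part (i + j)
  one_notMem : (GradedMonoid.GOne.one : A 0) ∉ part 0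
  mem_or_mem {i j : ℤ} {a : A i} {b : A j} :
    (GradedMonoid.GMul.mul a b : A (i + j)) ∈ part (i + j) → a ∈ part i ∨ b ∈ part j

variable {A}

/-- `V(S) = {𝔭 | S ⊆ 𝔭}`, for a set `S` of homogeneous elements. -/
def HomogSpec.zeroLocus (S : Set (Σ i, A i)) : Set (HomogSpec A) :=
  {p | ∀ x ∈ S, x.2 ∈ p.part x.1}

/-- The Zariski topology: the closed subsets are the `V(S)`. -/
instance : TopologicalSpace (HomogSpec A) :=
  TopologicalSpace.ofClosed (Set.range HomogSpec.zeroLocus)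
    ⟨{⟨0, GradedMonoid.GOne.one⟩}, by
      ext p
      simpa [HomogSpec.zeroLocus] using p.one_notMem⟩
    (by
      intro F hF
      have hF' : ∀ W ∈ F, ∃ S, HomogSpec.zeroLocus S = W := fun W hW => hF hW
      choose! S hS using hF'
      refine ⟨⋃ W ∈ F, S W, ?_⟩
      ext p
      simp only [HomogSpec.zeroLocus, Set.mem_iUnion, Set.mem_ofPred_eq, Set.mem_sInter]
      constructor
      · intro h W hW
        rw [← hS W hW]
        exact fun a ha => h a ⟨W, hW, ha⟩
      · rintro h a ⟨W, hW, ha⟩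
        have := h W hW
        rw [← hS W hW] at this
        exact this a ha)
    (by
      rintro _ ⟨S, rfl⟩ _ ⟨T, rfl⟩
      refine ⟨Set.image2 (fun a b => ⟨a.1 + b.1, GradedMonoid.GMul.mul a.2 b.2⟩) S T, ?_⟩
      ext p
      simp only [HomogSpec.zeroLocus, Set.mem_ofPred_eq, Set.mem_union, Set.forall_mem_image2]
      constructor
      · intro h
        by_contra! hc
        obtain ⟨⟨a, ha, ha'⟩, ⟨b, hb, hb'⟩⟩ := hc
        exact (p.mem_or_mem (h a ha b hb)).elim ha' hb'
      · rintro (h | h) a ha b hb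
        exacts [p.mul_mem_right _ (h a ha), p.mul_mem_left _ (h b hb)])

end HomogeneousSpectrum

/-! ### The comparison maps -/

section Comparison

variable {K : Type u} [Category.{v} K] [HasZeroObject K] [HasShift K ℤ]
  [Preadditive K] [∀ n : ℤ, (shiftFunctor K n).Additive] [Pretriangulated K]
  [IsTriangulated K] [MonoidalCategory K] [SymmetricCategory K] [TensorTriangulated K]

/-- `Z_Φ`, the intersection of the supports of the objects of `Φ`. -/
def suppSet (Φ : TensorMultSet K) : Set (Spc K) := ⋂ X ∈ Φ.carrier, supp X

/-- `ρ_Φ(P) = {[f] ∈ R_Φ | cone(f) ∉ P}`, as a subset of `R_Φ`. -/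
def rhoSet (Φ : TensorMultSet K) (P : Spc K) : Set (R Φ) :=
  {x | ∃ (X : K) (hX : X ∈ Φ.carrier) (f : balancedEnd X),
    x = R.mk hX f ∧ ¬ P.mem (cone (f.1 : X ⟶ X))}

/-- `ρ_Φ^•(P)`: the degree `i` part `{[f] ∈ R_Φ^i | cone(f) ∉ P}`, as a subset of `R_Φ^i`. -/
def gradedRhoSet (Φ : TensorMultSet K) (P : Spc K) (i : ℤ) : Set (GR Φ i) :=
  {x | ∃ (X : K) (hX : X ∈ Φ.carrier) (f : gradedEnd X i),
    x = GR.mk hX f ∧ ¬ P.mem (cone (f.1 : X ⟶ X⟦i⟧))}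

/-- `ρ_𝟙(P) = {f : 𝟙 ⟶ 𝟙 | cone(f) ∉ P}`, as a subset of the endomorphism ring of the unit. -/
def unitRhoSet (P : Spc K) : Set (End (𝟙_ K)) :=
  {f | ¬ P.mem (cone (f : 𝟙_ K ⟶ 𝟙_ K))}

end Comparison

end TTG

set_option linter.unusedSectionVars false

namespace TTG

/-! ### Cones and morphisms inverted modulo a thick subcategory -/

section Cones

variable {K : Type u} [Category.{v} K] [HasZeroObject K] [HasShift K ℤ]
  [Preadditive K] [∀ n : ℤ, (shiftFunctor K n).Additive] [Pretriangulated K]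

/-! For a prime `P`, the relation `cone f ∈ P` says that `f` becomes invertible in the Verdier
quotient by `P`; in Lean this is `P.mem.trW f`. So `ρ_Φ(P)` consists of the classes of the `f` that
are not invertible modulo `P`. For `a ∉ P` tensoring with `a` neither creates nor destroys
invertibility modulo `P`, so the condition depends only on the class `[f]`.

The engine is `Balanced.comp_self_whiskerRight_cone`: if `f` is tensor-balanced, then `f²` vanishes
on `cone f`. Balanced endomorphisms `f`, `g` of `X` commute up to sign after tensoring with `X`, by
the interchange law. If `fg` is invertible modulo `P`, then on `X ⊗ cone f` (after this tensoring)
its square is both zero and invertible modulo `P`; as `X ∉ P`, this forces `cone f ∈ P`. If `f + g`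
is invertible modulo `P`, its cube vanishes on `cone f ⊗ cone g`, so by primality one of the cones
lies in `P`. Hence `ρ_Φ(P)` is a prime ideal.

For the preimage statement, a proper closed set is `V(s)` for some `s` with an element `[f]` outside
some prime, so no power of `f` vanishes on an object of `Φ`. The objects killed by a power of `f`
form a thick tensor ideal (`isThickIdeal_nilpotent`) that contains `cone f` and misses `Φ`. Zorn's
lemma (`IsThickIdeal.exists_prime`) enlarges it to a prime `P` that still misses `Φ`. Then `P ∈
Z_Φ`, and `[f] ∉ ρ_Φ(P)`. Density follows by applying this to the closure of the image;
irreducibility follows from density and continuity. Most of the work is done for graded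
endomorphisms, and the ungraded case is read off in degree `0`. -/

lemma exists_cone_triangle {X Y : K} (f : X ⟶ Y) :
    ∃ (g : Y ⟶ cone f) (h : cone f ⟶ X⟦(1 : ℤ)⟧), Triangle.mk f g h ∈ distTriang K :=
  (distinguished_cocone_triangle f).choose_spec

lemma trW_iff_cone (J : ObjectProperty K) [J.IsClosedUnderIsomorphisms] {X Y : K} (f : X ⟶ Y) :
    J.trW f ↔ J (cone f) := by
  obtain ⟨g, h, hT⟩ := exists_cone_triangle f
  exact J.trW_iff_of_distinguished _ hT

/-- The triangle on a zero morphism splits, so `X⟦1⟧` is a retract of the cone. This is how a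
morphism that is both zero and invertible modulo `J` forces its source into `J`. -/
lemma prop_of_trW_zero (J : ObjectProperty K) [J.IsTriangulated] [J.IsStableUnderRetracts]
    {X Y : K} (h : J.trW (0 : X ⟶ Y)) : J X := by
  obtain ⟨Z, g, k, hT, hZ⟩ := h
  obtain ⟨s, hs⟩ := Triangle.coyoneda_exact₁ _ hT (𝟙 _) ((Category.id_comp _).trans ((shiftFunctor K (1 : ℤ)).map_zero _ _))
  have hX : J (X⟦(1 : ℤ)⟧) := J.prop_of_retract ⟨s, k, hs.symm⟩ hZ
  exact (J.prop_shift_iff_of_isStableUnderShift X (1 : ℤ)).1 hX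

end Cones

/-- The Koszul sign enters as a unit of the centre of `K`. Its parity is forgotten, because every
later argument works up to sign. -/
lemma catCenter_neg_one_zpow_app {K : Type u} [Category.{v} K] [Preadditive K] (m : ℤ) (Z : K) :
    ((((-1 : (CatCenter K)ˣ) ^ m : (CatCenter K)ˣ) : CatCenter K).app Z = 𝟙 Z) ∨
    ((((-1 : (CatCenter K)ˣ) ^ m : (CatCenter K)ˣ) : CatCenter K).app Z = - 𝟙 Z) := by
  rcases Int.even_or_odd m with h | h
  · left; rw [h.neg_one_zpow]; rfl
  · right; rw [h.neg_one_zpow]; rfl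

/-! ### Suspension isomorphisms and the graded interchange law -/

section Interchange

variable {K : Type u} [Category.{v} K] [HasZeroObject K] [HasShift K ℤ]
  [Preadditive K] [∀ n : ℤ, (shiftFunctor K n).Additive] [Pretriangulated K]
  [IsTriangulated K] [MonoidalCategory K] [SymmetricCategory K] [TensorTriangulated K]

lemma tensorLeft_shift_naturality (X : K) {Y Y' : K} (g : Y ⟶ Y') (n : ℤ) :
    X ◁ g⟦n⟧' ≫ ((tensorLeft X).commShiftIso n).hom.app Y' =
      ((tensorLeft X).commShiftIso n).hom.app Y ≫ (X ◁ g)⟦n⟧' :=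
  ((tensorLeft X).commShiftIso n).hom.naturality g

lemma tensorRight_shift_naturality (Y : K) {X X' : K} (f : X ⟶ X') (n : ℤ) :
    f⟦n⟧' ▷ Y ≫ ((tensorRight Y).commShiftIso n).hom.app X' =
      ((tensorRight Y).commShiftIso n).hom.app X ≫ (f ▷ Y)⟦n⟧' :=
  ((tensorRight Y).commShiftIso n).hom.naturality f

lemma whiskerRight_shift {X X' : K} (f : X ⟶ X') (Y : K) (n : ℤ) :
    f ▷ (Y⟦n⟧) ≫ ((tensorLeft X').commShiftIso n).hom.app Y =
      ((tensorLeft X).commShiftIso n).hom.app Y ≫ (f ▷ Y)⟦n⟧' :=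
  (NatTrans.shift_app_comm ((curriedTensor K).map f) n Y).symm

lemma whiskerLeft_shift {Y Y' : K} (X : K) (g : Y ⟶ Y') (n : ℤ) :
    (X⟦n⟧) ◁ g ≫ ((tensorRight Y').commShiftIso n).hom.app X =
      ((tensorRight Y).commShiftIso n).hom.app X ≫ (X ◁ g)⟦n⟧' :=
  (NatTrans.shift_app_comm ((curriedTensor K).flip.map g) n X).symm

lemma commShift_comm (X Y : K) (m n : ℤ) :
    ((tensorLeft (X⟦m⟧)).commShiftIso n).hom.app Y ≫
        (((tensorRight Y).commShiftIso m).hom.app X)⟦n⟧' =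
      ((tensorRight (Y⟦n⟧)).commShiftIso m).hom.app X ≫
        (((tensorLeft X).commShiftIso n).hom.app Y)⟦m⟧' ≫ (shiftComm (X ⊗ Y) m n).inv ∨
    ((tensorLeft (X⟦m⟧)).commShiftIso n).hom.app Y ≫
        (((tensorRight Y).commShiftIso m).hom.app X)⟦n⟧' =
      - (((tensorRight (Y⟦n⟧)).commShiftIso m).hom.app X ≫
        (((tensorLeft X).commShiftIso n).hom.app Y)⟦m⟧' ≫ (shiftComm (X ⊗ Y) m n).inv) := by
  have h := (curriedTensor K).commShift₂_comm .int X Y m n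
  refine (catCenter_neg_one_zpow_app (K := K) (m * n) ((X ⊗ Y)⟦m⟧⟦n⟧)).imp
    (fun h' => h.trans ?_) (fun h' => h.trans ?_)
  · erw [h', Category.comp_id]
    rfl
  · erw [h', Preadditive.comp_neg, Preadditive.comp_neg, Preadditive.comp_neg, Category.comp_id]
    rfl

/-- The interchange law for graded morphisms, up to sign. -/
lemma map_tensorRight_comp_map_tensorLeft {X X' Y Y' : K} {i j k : ℤ} (f : ShiftedHom X X' i)
    (g : ShiftedHom Y Y' j) (h : j + i = k) (h' : i + j = k) :
    (f.map (tensorRight Y)).comp (g.map (tensorLeft X')) h =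
        (g.map (tensorLeft X)).comp (f.map (tensorRight Y')) h' ∨
      (f.map (tensorRight Y)).comp (g.map (tensorLeft X')) h =
        - (g.map (tensorLeft X)).comp (f.map (tensorRight Y')) h' := by
  -- Both composites begin with `f ▷ Y ≫ (X'⟦i⟧) ◁ g`. What remains are the two identifications of
  -- `X'⟦i⟧ ⊗ Y'⟦j⟧` with `(X' ⊗ Y')⟦k⟧`, which agree up to sign.
  have e₁ : (f.map (tensorRight Y)).comp (g.map (tensorLeft X')) h =
      f ▷ Y ≫ (X'⟦i⟧) ◁ g ≫ ((tensorRight (Y'⟦j⟧)).commShiftIso i).hom.app X' ≫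
        (((tensorLeft X').commShiftIso j).hom.app Y')⟦i⟧' ≫
          (shiftFunctorAdd' K j i k h).inv.app (X' ⊗ Y') := by
    have := whiskerLeft_shift X' g i
    simp only [ShiftedHom.comp, ShiftedHom.map, Functor.map_comp, Category.assoc]
    dsimp at this ⊢
    rw [reassoc_of% this]
  have e₂ : (g.map (tensorLeft X)).comp (f.map (tensorRight Y')) h' =
      f ▷ Y ≫ (X'⟦i⟧) ◁ g ≫ ((tensorLeft (X'⟦i⟧)).commShiftIso j).hom.app Y' ≫
        (((tensorRight Y').commShiftIso i).hom.app X')⟦j⟧' ≫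
          (shiftFunctorAdd' K i j k h').inv.app (X' ⊗ Y') := by
    have := whiskerRight_shift f Y' j
    simp only [ShiftedHom.comp, ShiftedHom.map, Functor.map_comp, Category.assoc]
    dsimp at this ⊢
    rw [← reassoc_of% this, whisker_exchange_assoc]
  have e₃ : (shiftComm (X' ⊗ Y') i j).inv ≫ (shiftFunctorAdd' K i j k h').inv.app _ =
      (shiftFunctorAdd' K j i k h).inv.app _ := by
    rw [shiftComm, shiftFunctorComm_eq K i j k h']
    simp
  rw [e₁, e₂]
  refine (commShift_comm X' Y' i j).imp (fun h => ?_) (fun h => ?_)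
  · rw [reassoc_of% h, e₃]
  · have h := congr($h ≫ (shiftFunctorAdd' K i j k h').inv.app (X' ⊗ Y'))
    simp only [Preadditive.neg_comp, Category.assoc, e₃] at h
    rw [h]
    simp

end Interchange

/-! ### Objects on which a morphism vanishes -/

section Annihilation

variable {K : Type u} [Category.{v} K] [HasZeroObject K] [HasShift K ℤ]
  [Preadditive K] [∀ n : ℤ, (shiftFunctor K n).Additive] [Pretriangulated K]
  [IsTriangulated K] [MonoidalCategory K] [SymmetricCategory K] [TensorTriangulated K]

lemma whiskerRight_eq_zero_of_retract {X Y : K} {g : X ⟶ Y} {Z Z' : K} (r : Retract Z' Z)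
    (h : g ▷ Z = 0) : g ▷ Z' = 0 := by
  have e : g ▷ Z' = X ◁ r.i ≫ g ▷ Z ≫ Y ◁ r.r := by
    rw [← whisker_exchange, ← whiskerLeft_comp_assoc, r.retract]
    simp
  simp [e, h]

lemma whiskerRight_tensor_eq_zero {X Y : K} {g : X ⟶ Y} {Z : K} (a : K)
    (h : g ▷ Z = 0) : g ▷ (Z ⊗ a) = 0 := by
  simp [h]

lemma whiskerRight_tensor_eq_zero' {X Y : K} {g : X ⟶ Y} {Z : K} (a : K)
    (h : g ▷ Z = 0) : g ▷ (a ⊗ Z) = 0 :=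
  whiskerRight_eq_zero_of_retract (Retract.ofIso (β_ a Z)) (whiskerRight_tensor_eq_zero a h)

lemma whiskerRight_shift_eq_zero {X Y : K} {g : X ⟶ Y} {Z : K} (n : ℤ)
    (h : g ▷ Z = 0) : g ▷ (Z⟦n⟧) = 0 := by
  rw [← cancel_mono (((tensorLeft Y).commShiftIso n).hom.app Z), whiskerRight_shift, h]
  simp

lemma shift_whiskerRight_eq_zero {X Y : K} {g : X ⟶ Y} {Z : K} (n : ℤ)
    (h : g ▷ Z = 0) : (g⟦n⟧') ▷ Z = 0 := by
  rw [← cancel_mono (((tensorRight Z).commShiftIso n).hom.app Y), tensorRight_shift_naturality, h]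
  simp

/-- If `h` vanishes on the third and `g` on the first object of a distinguished triangle, then
`h ≫ g` vanishes on the second. -/
lemma comp_whiskerRight_eq_zero {A B C : K} {h : A ⟶ B} {g : B ⟶ C} {T : Triangle K}
    (hT : T ∈ distTriang K) (h₃ : h ▷ T.obj₃ = 0) (h₁ : g ▷ T.obj₁ = 0) :
    (h ≫ g) ▷ T.obj₂ = 0 := by
  -- `h ▷ T.obj₂` dies in `B ⊗ T.obj₃`, so it lifts to `B ⊗ T.obj₁`, where `g` vanishes.
  obtain ⟨t, ht⟩ : ∃ t : A ⊗ T.obj₂ ⟶ B ⊗ T.obj₁, h ▷ T.obj₂ = t ≫ B ◁ T.mor₁ :=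
    Triangle.coyoneda_exact₂ _ ((tensorLeft B).map_distinguished T hT) (h ▷ T.obj₂) (by
      change h ▷ T.obj₂ ≫ B ◁ T.mor₂ = 0
      rw [← whisker_exchange, h₃, comp_zero])
  rw [comp_whiskerRight, ht, Category.assoc, whisker_exchange, h₁, zero_comp, comp_zero]

/-- Tensor-balanced graded endomorphisms. -/
def Balanced {X : K} {i : ℤ} (f : ShiftedHom X X i) : Prop :=
  f.map (tensorRight X) = f.map (tensorLeft X)

lemma Balanced.whiskerRight_eq {X : K} {i : ℤ} {f : ShiftedHom X X i} (hf : Balanced f) :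
    f ▷ X = X ◁ f ≫ ((tensorLeft X).commShiftIso i).hom.app X ≫
      ((tensorRight X).commShiftIso i).inv.app X := by
  have h : f ▷ X ≫ ((tensorRight X).commShiftIso i).hom.app X =
    X ◁ f ≫ ((tensorLeft X).commShiftIso i).hom.app X := hf
  rw [← reassoc_of% h]
  simp

/-- Balancedness moves `f` to the right-hand factor, where it is followed by `p`. It is given on `X
⊗ X` but needed on `X ⊗ X⟦i⟧`; the suspension in between costs a sign. -/
lemma shift_whiskerRight_comp_eq_zero {X : K} {i : ℤ} {f : ShiftedHom X X i} (hf : Balanced f)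
    {C : K} {p : X⟦i⟧ ⟶ C} (hp : f ≫ p = 0) :
    f ▷ (X⟦i⟧) ≫ (X⟦i⟧) ◁ p = 0 := by
  have key : f ▷ (X⟦i⟧) ≫ ((tensorRight (X⟦i⟧)).commShiftIso i).hom.app X =
        ((tensorLeft X).commShiftIso i).hom.app X ≫ (X ◁ f)⟦i⟧' ∨
      f ▷ (X⟦i⟧) ≫ ((tensorRight (X⟦i⟧)).commShiftIso i).hom.app X =
        - (((tensorLeft X).commShiftIso i).hom.app X ≫ (X ◁ f)⟦i⟧') := by
    have hf' : f.map (tensorRight X) = X ◁ f ≫ ((tensorLeft X).commShiftIso i).hom.app X := hf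
    -- The identity of `X⟦i⟧`, read as a morphism `X⟦i⟧ ⟶ X` of degree `i`, turns the interchange
    -- law into the required change of the right-hand factor.
    have h := map_tensorRight_comp_map_tensorLeft f (𝟙 (X⟦i⟧) : ShiftedHom (X⟦i⟧) X i) rfl rfl
    rw [hf'] at h
    have e : ShiftedHom.map (X := X⟦i⟧) (Y := X) (a := i) (𝟙 (X⟦i⟧)) (tensorLeft X) =
        ((tensorLeft X).commShiftIso i).hom.app X := by
      simp [ShiftedHom.map]
    rw [e] at h
    simp only [ShiftedHom.comp, Functor.map_comp] at h
    refine h.imp (fun h => ?_) (fun h => ?_)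
    · rw [← cancel_mono ((((tensorLeft X).commShiftIso i).hom.app X)⟦i⟧'),
        ← cancel_mono ((shiftFunctorAdd' K i i (i + i) rfl).inv.app (X ⊗ X))]
      simpa [ShiftedHom.map] using h
    · rw [← cancel_mono ((((tensorLeft X).commShiftIso i).hom.app X)⟦i⟧'),
        ← cancel_mono ((shiftFunctorAdd' K i i (i + i) rfl).inv.app (X ⊗ X))]
      simpa [ShiftedHom.map] using h
  have hz : (X ◁ f)⟦i⟧' ≫ (X ◁ p)⟦i⟧' = 0 := by
    rw [← Functor.map_comp, ← whiskerLeft_comp, hp]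
    simp
  rw [← cancel_mono (((tensorRight C).commShiftIso i).hom.app X), Category.assoc,
    whiskerLeft_shift, zero_comp]
  rcases key with key | key
  · rw [reassoc_of% key, hz, comp_zero]
  · rw [← Category.assoc, key, Preadditive.neg_comp, Category.assoc, hz, comp_zero, neg_zero]

/-- The square of a tensor-balanced graded endomorphism vanishes on its cone. -/
lemma Balanced.comp_self_whiskerRight_cone {X : K} {i k : ℤ} {f : ShiftedHom X X i}
    (hf : Balanced f) (hk : i + i = k) : (f.comp f hk) ▷ cone f = 0 := by
  obtain ⟨p, q, hT⟩ := exists_cone_triangle f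
  have hfp : f ≫ p = 0 := comp_distTriang_mor_zero₁₂ _ hT
  have hqf : q ≫ f⟦(1 : ℤ)⟧' = 0 := comp_distTriang_mor_zero₃₁ _ hT
  -- The first factor of the square: followed by `q`, the morphism `f ▷ cone f` becomes `f` on `X ⊗
  -- X⟦1⟧` after `X ◁ q`. By balancedness this contains `q ≫ f⟦1⟧' = 0`, so `f ▷ cone f` lifts along
  -- `p`.
  obtain ⟨t, ht⟩ : ∃ t : X ⊗ cone f ⟶ (X⟦i⟧) ⊗ (X⟦i⟧), f ▷ cone f = t ≫ (X⟦i⟧) ◁ p :=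
    Triangle.coyoneda_exact₃ _ ((tensorLeft (X⟦i⟧)).map_distinguished _ hT) (f ▷ cone f) (by
      change f ▷ cone f ≫ (X⟦i⟧) ◁ q ≫ ((tensorLeft (X⟦i⟧)).commShiftIso (1 : ℤ)).hom.app X = 0
      have := tensorLeft_shift_naturality X f 1
      rw [← whisker_exchange_assoc, whiskerRight_shift, hf.whiskerRight_eq, Functor.map_comp,
        ← reassoc_of% this, ← whiskerLeft_comp_assoc, hqf]
      simp)
  -- The second factor kills whatever comes from `p`: up to suspension isomorphisms this is the
  -- `i`-th suspension of `f ▷ (X⟦i⟧) ≫ (X⟦i⟧) ◁ p`, which vanishes because `f ≫ p = 0`.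
  have h₂ : (X⟦i⟧) ◁ p ≫ f⟦i⟧' ▷ cone f = 0 := by
    rw [whisker_exchange, ← cancel_mono (((tensorRight (cone f)).commShiftIso i).hom.app _),
      Category.assoc, whiskerLeft_shift]
    have := tensorRight_shift_naturality (X⟦i⟧) f i
    rw [reassoc_of% this, ← Functor.map_comp, shift_whiskerRight_comp_eq_zero hf hfp]
    simp
  rw [ShiftedHom.comp, comp_whiskerRight, comp_whiskerRight, ht, Category.assoc, reassoc_of% h₂]
  simp

end Annihilation

/-! ### Nilpotency of products and sums that commute up to sign -/

section GradedSquareZero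

variable {K : Type u} [Category.{v} K] [HasShift K ℤ]
  [Preadditive K] [∀ n : ℤ, (shiftFunctor K n).Additive]

/-- Equality up to sign. -/
def EqUpToSign {G : Type*} [Neg G] (a b : G) : Prop := a = b ∨ a = -b

lemma EqUpToSign.symm {G : Type*} [InvolutiveNeg G] {a b : G} (h : EqUpToSign a b) :
    EqUpToSign b a :=
  h.imp Eq.symm (fun h => by rw [h, neg_neg])

/-- Swapping the first pair in `F G F G` gives `± G F F G`, with the zero square in the middle. -/
lemma comp_sq_eq_zero {Z : K} {i j k : ℤ} {F : ShiftedHom Z Z i} {G : ShiftedHom Z Z j}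
    (h : j + i = k) (h' : i + j = k) (hFG : EqUpToSign (F.comp G h) (G.comp F h'))
    (hF : F.comp F rfl = 0) : (F.comp G h).comp (F.comp G h) rfl = 0 := by
  have key : (G.comp F h').comp (F.comp G h) rfl = 0 := by
    rw [ShiftedHom.comp_assoc G F (F.comp G h) h' (a₂₃ := k + i) rfl (by omega),
      ← ShiftedHom.comp_assoc F F G rfl h (by omega), hF, ShiftedHom.zero_comp,
      ShiftedHom.comp_zero]
  rcases hFG with e | e
  · nth_rw 1 [e]
    exact key
  · nth_rw 1 [e]
    rw [ShiftedHom.neg_comp, key, neg_zero]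

/-- A word of length three in `F` and `G` repeats a letter, and up to sign the two copies can be
made adjacent. -/
lemma add_comp_cube_eq_zero {Z : K} {i k l : ℤ} {F G : ShiftedHom Z Z i}
    (hk : i + i = k) (hl : k + i = l) (hFG : EqUpToSign (F.comp G hk) (G.comp F hk))
    (hF : F.comp F hk = 0) (hG : G.comp G hk = 0) :
    (F + G).comp ((F + G).comp (F + G) hk) hl = 0 := by
  have h₁ : F.comp (F.comp G hk) hl = 0 := by
    rw [← ShiftedHom.comp_assoc F F G hk hk (by omega), hF, ShiftedHom.zero_comp]
  have h₂ : G.comp (G.comp F hk) hl = 0 := by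
    rw [← ShiftedHom.comp_assoc G G F hk hk (by omega), hG, ShiftedHom.zero_comp]
  have h₃ : F.comp (G.comp F hk) hl = 0 := by
    rcases hFG with e | e
    · rw [← e, h₁]
    · rw [← neg_eq_iff_eq_neg.2 e, ShiftedHom.comp_neg, h₁, neg_zero]
  have h₄ : G.comp (F.comp G hk) hl = 0 := by
    rcases hFG with e | e
    · rw [e, h₂]
    · rw [e, ShiftedHom.comp_neg, h₂, neg_zero]
  simp only [ShiftedHom.add_comp, ShiftedHom.comp_add, hF, hG, h₁, h₂, h₃, h₄,
    ShiftedHom.comp_zero, add_zero]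

end GradedSquareZero

attribute [instance] Spc.isTriangulated Spc.isStableUnderRetracts

/-! ### Invertibility modulo a prime -/

section Prime

variable {K : Type u} [Category.{v} K] [HasZeroObject K] [HasShift K ℤ]
  [Preadditive K] [∀ n : ℤ, (shiftFunctor K n).Additive] [Pretriangulated K]
  [IsTriangulated K] [MonoidalCategory K] [SymmetricCategory K] [TensorTriangulated K]

lemma Balanced.map_tensorRight {X : K} {i : ℤ} {f : ShiftedHom X X i} (hf : Balanced f) (Y : K) :
    Balanced (f.map (tensorRight Y)) :=
  (shiftedEndSystem K i).right_balanced Y f hf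

lemma Balanced.comp {X : K} {i j k : ℤ} {f : ShiftedHom X X i} {g : ShiftedHom X X j}
    (hf : Balanced f) (hg : Balanced g) (h : j + i = k) : Balanced (f.comp g h) := by
  unfold Balanced at *
  rw [ShiftedHom.map_comp, ShiftedHom.map_comp, hf, hg]

/-- Tensor-balanced graded endomorphisms commute up to sign after tensoring with the object. -/
lemma Balanced.comm {X : K} {i j k : ℤ} {f : ShiftedHom X X i} {g : ShiftedHom X X j}
    (hg : Balanced g) (h : j + i = k) (h' : i + j = k) :
    EqUpToSign ((f.map (tensorRight X)).comp (g.map (tensorRight X)) h)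
      ((g.map (tensorRight X)).comp (f.map (tensorRight X)) h') := by
  rw [show g.map (tensorRight X) = g.map (tensorLeft X) from hg]
  exact map_tensorRight_comp_map_tensorLeft f g h h'

lemma map_tensorRight_comp_eq_zero {X Z : K} {i j k : ℤ} {f : ShiftedHom X X i}
    {g : ShiftedHom X X j} {h : j + i = k} (hz : (f.comp g h) ▷ Z = 0) :
    (f.map (tensorRight Z)).comp (g.map (tensorRight Z)) h = 0 := by
  rw [← ShiftedHom.map_comp]
  change (f.comp g h) ▷ Z ≫ _ = 0
  rw [hz, zero_comp]

namespace Spc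

variable (P : Spc K)

lemma trW_map_iff {X Y : K} {i : ℤ} (f : ShiftedHom X Y i) (F : K ⥤ K) [F.CommShift ℤ] :
    P.mem.trW (f.map F) ↔ P.mem.trW (F.map f) :=
  MorphismProperty.cancel_right_of_respectsIso _ _ _

lemma trW_comp {X Y Z : K} {i j k : ℤ} {f : ShiftedHom X Y i} {g : ShiftedHom Y Z j}
    (hf : P.mem.trW f) (hg : P.mem.trW g) (h : j + i = k) : P.mem.trW (f.comp g h) :=
  P.mem.trW.comp_mem _ _ hf (P.mem.trW.comp_mem _ _ (hg.shift i) (P.mem.trW_of_isIso _))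

lemma trW_neg_iff {X Y : K} (f : X ⟶ Y) : P.mem.trW (-f) ↔ P.mem.trW f := by
  simpa using P.mem.smul_mem_trW_iff f (-1)

lemma trW_whiskerRight {X Y : K} {f : X ⟶ Y} (hf : P.mem.trW f) (a : K) :
    P.mem.trW (f ▷ a) := by
  obtain ⟨Z, g, h, hT, hZ⟩ := hf
  exact ObjectProperty.trW.mk _ ((tensorRight a).map_distinguished _ hT) (P.tensor_right a hZ)

variable {P}

lemma mem_tensor_right_iff {a : K} (ha : ¬ P.mem a) (b : K) : P.mem (b ⊗ a) ↔ P.mem b :=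
  ⟨fun h => (P.mem_or_mem h).resolve_right ha, P.tensor_right a⟩

lemma mem_tensor_left_iff {a : K} (ha : ¬ P.mem a) (b : K) : P.mem (a ⊗ b) ↔ P.mem b :=
  ⟨fun h => (P.mem_or_mem h).resolve_left ha, P.tensor_left a⟩

/-- Primality makes `P` its own inverse image under the exact functor `- ⊗ a`. This is why `ρ_Φ(P)`
does not depend on representatives. -/
lemma trW_whiskerRight_iff {a : K} (ha : ¬ P.mem a) {X Y : K} (f : X ⟶ Y) :
    P.mem.trW (f ▷ a) ↔ P.mem.trW f := by
  have h : P.mem.inverseImage (tensorRight a) = P.mem := by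
    ext b
    exact mem_tensor_right_iff ha b
  have := P.mem.inverseImage_trW_iff (tensorRight a) f
  rw [h] at this
  exact this.symm

lemma trW_whiskerLeft_iff {a : K} (ha : ¬ P.mem a) {X Y : K} (f : X ⟶ Y) :
    P.mem.trW (a ◁ f) ↔ P.mem.trW f := by
  have h : P.mem.inverseImage (tensorLeft a) = P.mem := by
    ext b
    exact mem_tensor_left_iff ha b
  have := P.mem.inverseImage_trW_iff (tensorLeft a) f
  rw [h] at this
  exact this.symm

lemma trW_map_tensorRight_iff {a : K} (ha : ¬ P.mem a) {X Y : K} {i : ℤ} (f : ShiftedHom X Y i) :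
    P.mem.trW (f.map (tensorRight a)) ↔ P.mem.trW f :=
  (P.trW_map_iff f _).trans (trW_whiskerRight_iff ha f)

lemma trW_map_tensorLeft_iff {a : K} (ha : ¬ P.mem a) {X Y : K} {i : ℤ} (f : ShiftedHom X Y i) :
    P.mem.trW (f.map (tensorLeft a)) ↔ P.mem.trW f :=
  (P.trW_map_iff f _).trans (trW_whiskerLeft_iff ha f)

/-- On `X ⊗ cone f` the square of the product is zero, since `f²` vanishes there, yet it is still
invertible modulo `P`. So `X ⊗ cone f ∈ P`. -/
lemma mem_cone_of_trW_comp_of_comm {X : K} (hX : ¬ P.mem X) {i j k : ℤ} {f : ShiftedHom X X i}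
    {g : ShiftedHom X X j} (hf : Balanced f) (h : j + i = k) (h' : i + j = k)
    (hc : EqUpToSign (f.comp g h) (g.comp f h')) (hW : P.mem.trW (f.comp g h)) :
    P.mem (cone f) := by
  have hF := map_tensorRight_comp_eq_zero (hf.comp_self_whiskerRight_cone rfl)
  have hc' : EqUpToSign ((f.map (tensorRight (cone f))).comp (g.map (tensorRight (cone f))) h)
      ((g.map (tensorRight (cone f))).comp (f.map (tensorRight (cone f))) h') := by
    rw [← ShiftedHom.map_comp, ← ShiftedHom.map_comp]
    refine hc.imp (fun e => by rw [e]) (fun e => ?_)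
    rw [e]
    simp [ShiftedHom.map]
  have hW' : P.mem.trW ((f.comp g h).map (tensorRight (cone f))) :=
    (P.trW_map_iff _ _).2 (P.trW_whiskerRight hW _)
  rw [ShiftedHom.map_comp] at hW'
  have hz := P.trW_comp hW' hW' rfl
  rw [comp_sq_eq_zero h h' hc' hF] at hz
  exact (mem_tensor_left_iff hX _).1 (prop_of_trW_zero _ hz)

lemma trW_of_trW_comp_of_comm {X : K} (hX : ¬ P.mem X) {i j k : ℤ} {f : ShiftedHom X X i}
    {g : ShiftedHom X X j} (hf : Balanced f) (h : j + i = k) (h' : i + j = k)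
    (hc : EqUpToSign (f.comp g h) (g.comp f h')) (hW : P.mem.trW (f.comp g h)) :
    P.mem.trW f :=
  (trW_iff_cone _ _).2 (mem_cone_of_trW_comp_of_comm hX hf h h' hc hW)

/-- Commutation up to sign is available only after tensoring with `X`; as `X ∉ P`, this passage
changes nothing modulo `P`. -/
lemma trW_comp_iff {X : K} (hX : ¬ P.mem X) {i j k : ℤ} {f : ShiftedHom X X i}
    {g : ShiftedHom X X j} (hf : Balanced f) (hg : Balanced g) (h : j + i = k) :
    P.mem.trW (f.comp g h) ↔ P.mem.trW f ∧ P.mem.trW g := by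
  refine ⟨fun hW => ?_, fun hW => P.trW_comp hW.1 hW.2 h⟩
  have hXX : ¬ P.mem (X ⊗ X) := fun h => (P.mem_or_mem h).elim hX hX
  have h' : i + j = k := by omega
  have hc := hg.comm (f := f) h h'
  rw [← trW_map_tensorRight_iff hX, ShiftedHom.map_comp] at hW
  rw [← trW_map_tensorRight_iff hX f, ← trW_map_tensorRight_iff hX g]
  refine ⟨trW_of_trW_comp_of_comm hXX (hf.map_tensorRight X) h h' hc hW,
    trW_of_trW_comp_of_comm hXX (hg.map_tensorRight X) h' h hc.symm ?_⟩
  rcases hc.symm with e | e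
  · rwa [e]
  · rw [e]
    exact (P.trW_neg_iff _).2 hW

/-- On `cone f ⊗ cone g` both squares vanish, hence so does the cube of the sum. Being invertible
modulo `P` as well, it puts `X ⊗ (cone f ⊗ cone g)` into `P`, and primality selects a cone. -/
lemma trW_or_trW_of_add_of_comm {X : K} (hX : ¬ P.mem X) {i : ℤ} {f g : ShiftedHom X X i}
    (hf : Balanced f) (hg : Balanced g) (hc : EqUpToSign (f.comp g rfl) (g.comp f rfl))
    (hW : P.mem.trW (f + g)) : P.mem.trW f ∨ P.mem.trW g := by
  have hF := map_tensorRight_comp_eq_zero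
    (whiskerRight_tensor_eq_zero (cone g) (hf.comp_self_whiskerRight_cone rfl))
  have hG := map_tensorRight_comp_eq_zero
    (whiskerRight_tensor_eq_zero' (cone f) (hg.comp_self_whiskerRight_cone rfl))
  let Q := cone f ⊗ cone g
  have hc' : EqUpToSign ((f.map (tensorRight Q)).comp (g.map (tensorRight Q)) rfl)
      ((g.map (tensorRight Q)).comp (f.map (tensorRight Q)) rfl) := by
    rw [← ShiftedHom.map_comp, ← ShiftedHom.map_comp]
    refine hc.imp (fun e => by rw [e]) (fun e => ?_)
    rw [e]
    simp [ShiftedHom.map]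
  have hW' : P.mem.trW ((f + g).map (tensorRight Q)) :=
    (P.trW_map_iff _ _).2 (P.trW_whiskerRight hW _)
  rw [ShiftedHom.map_add] at hW'
  have hz := P.trW_comp hW' (P.trW_comp hW' hW' rfl) rfl
  rw [add_comp_cube_eq_zero rfl rfl hc' hF hG] at hz
  rw [trW_iff_cone, trW_iff_cone]
  exact P.mem_or_mem ((mem_tensor_left_iff hX _).1 (prop_of_trW_zero _ hz))

lemma trW_or_trW_of_add {X : K} (hX : ¬ P.mem X) {i : ℤ} {f g : ShiftedHom X X i}
    (hf : Balanced f) (hg : Balanced g) (hW : P.mem.trW (f + g)) :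
    P.mem.trW f ∨ P.mem.trW g := by
  have hXX : ¬ P.mem (X ⊗ X) := fun h => (P.mem_or_mem h).elim hX hX
  rw [← trW_map_tensorRight_iff hX, ShiftedHom.map_add] at hW
  rw [← trW_map_tensorRight_iff hX f, ← trW_map_tensorRight_iff hX g]
  exact trW_or_trW_of_add_of_comm hXX (hf.map_tensorRight X) (hg.map_tensorRight X)
    (hg.comm rfl rfl) hW

lemma not_trW_zero {X : K} (hX : ¬ P.mem X) (i : ℤ) : ¬ P.mem.trW (0 : ShiftedHom X X i) :=
  fun h => hX (prop_of_trW_zero _ h)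

lemma trW_mk₀_iff {X Y : K} (f : X ⟶ Y) :
    P.mem.trW (ShiftedHom.mk₀ (0 : ℤ) rfl f) ↔ P.mem.trW f :=
  MorphismProperty.cancel_right_of_respectsIso _ _ _

end Spc

end Prime

/-! ### Existence of primes by Zorn's lemma -/

section ExistencePrime

variable {K : Type u} [Category.{v} K] [HasZeroObject K] [HasShift K ℤ]
  [Preadditive K] [∀ n : ℤ, (shiftFunctor K n).Additive] [Pretriangulated K]
  [IsTriangulated K] [MonoidalCategory K] [SymmetricCategory K] [TensorTriangulated K]

/-- Thick tensor ideals. -/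
structure IsThickIdeal (J : ObjectProperty K) : Prop where
  zero {Z : K} : IsZero Z → J Z
  shift {Z : K} (n : ℤ) : J Z → J (Z⟦n⟧)
  ext₂ {T : Triangle K} : T ∈ distTriang K → J T.obj₁ → J T.obj₃ → J T.obj₂
  retract {Z Z' : K} : Retract Z' Z → J Z → J Z'
  tensor_right (a : K) {b : K} : J b → J (b ⊗ a)

namespace IsThickIdeal

variable {J : ObjectProperty K}

lemma tensor_left (hJ : IsThickIdeal J) (a : K) {b : K} (hb : J b) : J (a ⊗ b) :=
  hJ.retract (Retract.ofIso (β_ a b)) (hJ.tensor_right a hb)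

lemma isStableUnderRetracts (hJ : IsThickIdeal J) : J.IsStableUnderRetracts where
  of_retract r h := hJ.retract r h

open ZeroObject in
lemma isTriangulated (hJ : IsThickIdeal J) : J.IsTriangulated :=
  have := hJ.isStableUnderRetracts
  { exists_zero := ⟨0, isZero_zero K, hJ.zero (isZero_zero K)⟩
    isStableUnderShiftBy n := ⟨fun _ h => hJ.shift n h⟩
    ext₂' _ hT h₁ h₃ := J.le_isoClosure _ (hJ.ext₂ hT h₁ h₃) }

/-- This is the colon ideal `(J : a)`, which takes the place of `J + (a)` in the proof that maximal
ideals missing `Φ` are prime. -/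
lemma comap_tensorRight (hJ : IsThickIdeal J) (a : K) : IsThickIdeal fun b => J (b ⊗ a) where
  zero hZ := hJ.zero ((tensorRight a).map_isZero hZ)
  shift {Z} n h :=
    hJ.retract (Retract.ofIso (((tensorRight a).commShiftIso n).app Z)) (hJ.shift n h)
  ext₂ hT h₁ h₃ := hJ.ext₂ ((tensorRight a).map_distinguished _ hT) h₁ h₃
  retract r h := hJ.retract (r.map (tensorRight a)) h
  tensor_right b c h := by
    refine hJ.retract (Retract.ofIso ?_) (hJ.tensor_right b h)
    exact α_ c b a ≪≫ whiskerLeftIso c (β_ b a) ≪≫ (α_ c a b).symm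

lemma sUnion {c : Set (ObjectProperty K)} (hc : ∀ J ∈ c, IsThickIdeal J) (hchain : IsChain (· ≤ ·) c)
    (hne : c.Nonempty) : IsThickIdeal fun b => ∃ J ∈ c, J b where
  zero hZ := hne.imp fun J hJ => ⟨hJ, (hc J hJ).zero hZ⟩
  shift n := fun ⟨J, hJ, h⟩ => ⟨J, hJ, (hc J hJ).shift n h⟩
  ext₂ hT := by
    rintro ⟨J₁, hJ₁, h₁⟩ ⟨J₃, hJ₃, h₃⟩
    rcases hchain.total hJ₁ hJ₃ with h | h
    · exact ⟨J₃, hJ₃, (hc J₃ hJ₃).ext₂ hT (h _ h₁) h₃⟩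
    · exact ⟨J₁, hJ₁, (hc J₁ hJ₁).ext₂ hT h₁ (h _ h₃)⟩
  retract r := fun ⟨J, hJ, h⟩ => ⟨J, hJ, (hc J hJ).retract r h⟩
  tensor_right a _ := fun ⟨J, hJ, h⟩ => ⟨J, hJ, (hc J hJ).tensor_right a h⟩

/-- A thick tensor ideal that is disjoint from a tensor-multiplicative set of objects is contained
in a prime with the same property. -/
lemma exists_prime (hJ : IsThickIdeal J) (Φ : TensorMultSet K)
    (hΦ : ∀ Y ∈ Φ.carrier, ¬ J Y) :
    ∃ P : Spc K, J ≤ P.mem ∧ ∀ Y ∈ Φ.carrier, ¬ P.mem Y := by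
  obtain ⟨M, hJM, hM⟩ := zorn_le_nonempty₀
    {I : ObjectProperty K | IsThickIdeal I ∧ ∀ Y ∈ Φ.carrier, ¬ I Y}
    (fun c hc hchain I hI => ⟨fun b => ∃ J ∈ c, J b,
      ⟨sUnion (fun J hJ => (hc hJ).1) hchain ⟨I, hI⟩, fun Y hY ⟨J, hJ, h⟩ => (hc hJ).2 Y hY h⟩,
      fun J hJ b hb => ⟨J, hJ, hb⟩⟩) J ⟨hJ, hΦ⟩
  have hMt := hM.prop.1
  -- By maximality, every strictly larger thick tensor ideal meets `Φ`.
  have meets {I : ObjectProperty K} (hI : IsThickIdeal I) (hMI : M ≤ I) {a : K} (ha : I a)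
      (ha' : ¬ M a) : ∃ Y ∈ Φ.carrier, I Y := by
    by_contra! hc
    exact ha' (hM.le_of_ge ⟨hI, hc⟩ hMI a ha)
  refine ⟨{ mem := M
            isTriangulated := hMt.isTriangulated
            isStableUnderRetracts := hMt.isStableUnderRetracts
            tensor_left := fun a _ h => hMt.tensor_left a h
            tensor_right := fun b h => hMt.tensor_right b h
            exists_notMem := Φ.nonempty.imp hM.prop.2
            mem_or_mem := fun {a b} hab => ?_ }, hJM, hM.prop.2⟩
  by_contra! hc
  obtain ⟨ha, hb⟩ := hc
  -- `(M : b)` contains `a`, so it contains some `X ∈ Φ`; then `(M : X)` contains `b`, so it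
  -- contains some `Y ∈ Φ`. Now `Y ⊗ X` lies in both `M` and `Φ`.
  obtain ⟨X, hX, hXb⟩ := meets (hMt.comap_tensorRight b)
    (fun _ h => hMt.tensor_right b h) hab ha
  obtain ⟨Y, hY, hYX⟩ := meets (hMt.comap_tensorRight X)
    (fun _ h => hMt.tensor_right X h) (hMt.retract (Retract.ofIso (β_ b X)) hXb) hb
  exact hM.prop.2 _ (Φ.tensor_mem hY hX) hYX

end IsThickIdeal

/-- The positive powers of a graded endomorphism. -/
inductive IsPower {X : K} {i : ℤ} (f : ShiftedHom X X i) : ∀ {j : ℤ}, ShiftedHom X X j → Prop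
  | self : IsPower f f
  | comp {j k l : ℤ} {g : ShiftedHom X X j} {h : ShiftedHom X X k} (e : k + j = l) :
      IsPower f g → IsPower f h → IsPower f (g.comp h e)

lemma IsPower.balanced {X : K} {i j : ℤ} {f : ShiftedHom X X i} (hf : Balanced f)
    {g : ShiftedHom X X j} (hg : IsPower f g) : Balanced g := by
  induction hg with
  | self => exact hf
  | comp e _ _ h₁ h₂ => exact h₁.comp h₂ e

/-- The objects on which some power of a graded endomorphism vanishes form a thick tensor ideal. -/
lemma isThickIdeal_nilpotent {X : K} {i : ℤ} (f : ShiftedHom X X i) :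
    IsThickIdeal fun Z : K => ∃ (j : ℤ) (g : ShiftedHom X X j), IsPower f g ∧ g ▷ Z = 0 where
  zero hZ := ⟨i, f, .self, (((tensorLeft X).map_isZero hZ).eq_zero_of_src _)⟩
  shift n := fun ⟨j, g, hg, h⟩ => ⟨j, g, hg, whiskerRight_shift_eq_zero n h⟩
  ext₂ hT := by
    rintro ⟨j, g, hg, h₁⟩ ⟨k, h, hh, h₃⟩
    -- The graded composite is `h` followed by `g⟦k⟧'`, so `g` has to be suspended before the
    -- vanishing lemma for triangles applies.
    refine ⟨_, h.comp g rfl, .comp rfl hh hg, ?_⟩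
    have := comp_whiskerRight_eq_zero hT h₃ (shift_whiskerRight_eq_zero k h₁)
    rw [ShiftedHom.comp, ← Category.assoc, comp_whiskerRight, this, zero_comp]
  retract r := fun ⟨j, g, hg, h⟩ => ⟨j, g, hg, whiskerRight_eq_zero_of_retract r h⟩
  tensor_right a _ := fun ⟨j, g, hg, h⟩ => ⟨j, g, hg, whiskerRight_tensor_eq_zero a h⟩

/-- If no power of a tensor-balanced graded endomorphism `f` vanishes on an object of `Φ`, then
there is a prime that contains the cone of `f` and no object of `Φ`. -/
lemma Balanced.exists_prime {X : K} {i : ℤ} {f : ShiftedHom X X i} (hf : Balanced f)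
    (Φ : TensorMultSet K)
    (hΦ : ∀ {j : ℤ} (g : ShiftedHom X X j), IsPower f g → ∀ Y ∈ Φ.carrier, g ▷ Y ≠ 0) :
    ∃ P : Spc K, P.mem (cone f) ∧ ∀ Y ∈ Φ.carrier, ¬ P.mem Y := by
  obtain ⟨P, hP, hPΦ⟩ := (isThickIdeal_nilpotent f).exists_prime Φ
    (fun Y hY ⟨j, g, hg, h⟩ => hΦ g hg Y hY h)
  exact ⟨P, hP _ ⟨_, f.comp f rfl, .comp rfl .self .self, hf.comp_self_whiskerRight_cone rfl⟩, hPΦ⟩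

end ExistencePrime

/-! ### Density and irreducibility -/

section Topology

variable {X Y : Type*} [TopologicalSpace Y] {f : X → Y}

/-- The closure of the image is a closed set whose preimage is everything. -/
lemma denseRange_of_preimage_ne_univ
    (h : ∀ W : Set Y, IsClosed W → W ≠ Set.univ → f ⁻¹' W ≠ Set.univ) : DenseRange f := by
  rw [DenseRange, dense_iff_closure_eq]
  by_contra hc
  exact h _ isClosed_closure hc
    (Set.eq_univ_of_forall fun x => subset_closure (Set.mem_range_self x))

lemma irreducibleSpace_of_denseRange [TopologicalSpace X] [IrreducibleSpace X]
    (hf : Continuous f) (hd : DenseRange f) : IrreducibleSpace Y := by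
  have h := ((IrreducibleSpace.isIrreducible_univ X).image f hf.continuousOn).closure
  rw [Set.image_univ, hd.closure_range] at h
  exact irreducibleSpace_def Y |>.2 h

end Topology

/-- A predicate invariant under the two generating moves descends to the quotient as a `Prop`-valued
function, so no chain of moves has to be followed. -/
lemma BalancedSystem.iff_of_cls_eq {K : Type u} [Category.{v} K] [MonoidalCategory K]
    [SymmetricCategory K] {Φ : TensorMultSet K} {S : BalancedSystem K}
    (p : ∀ X : K, S.obj X → Prop)
    (hl : ∀ {a X : K}, a ∈ Φ.carrier → X ∈ Φ.carrier → ∀ f : S.obj X, p _ (S.left a f) ↔ p X f)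
    (hr : ∀ {a X : K}, a ∈ Φ.carrier → X ∈ Φ.carrier → ∀ f : S.obj X, p _ (S.right a f) ↔ p X f)
    {X Y : K} {hX : X ∈ Φ.carrier} {hY : Y ∈ Φ.carrier} {f : S.obj X} {g : S.obj Y}
    (h : S.cls hX f = S.cls hY g) : p X f ↔ p Y g :=
  iff_of_eq (congrArg (Quot.lift (fun q : Σ X : Φ.carrier, S.obj X => p q.1.1 q.2) (by
    rintro _ _ (⟨a, X, f⟩ | ⟨a, X, f⟩)
    · exact propext (hl a.2 X.2 f).symm
    · exact propext (hr a.2 X.2 f).symm)) h)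

/-! ### The ungraded comparison map and Balmer's map -/

section Ungraded

variable {K : Type u} [Category.{v} K] [HasZeroObject K] [HasShift K ℤ]
  [Preadditive K] [∀ n : ℤ, (shiftFunctor K n).Additive] [Pretriangulated K]
  [IsTriangulated K] [MonoidalCategory K] [SymmetricCategory K] [TensorTriangulated K]

lemma balanced_mk₀ {X : K} {f : X ⟶ X} (hf : f ▷ X = X ◁ f) :
    Balanced (ShiftedHom.mk₀ (0 : ℤ) rfl f) := by
  unfold Balanced
  rw [ShiftedHom.map_mk₀, ShiftedHom.map_mk₀]
  exact congrArg _ hf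

/-- In degree `0` the inductively defined powers are the ring powers. The equation `j = 0` is
carried along because degrees of composites are only propositionally `0`. -/
lemma IsPower.exists_pow {X : K} {f : End X} {j : ℤ} {g : ShiftedHom X X j}
    (hg : IsPower (ShiftedHom.mk₀ (0 : ℤ) rfl (f : X ⟶ X)) g) :
    ∃ (hj : j = 0) (n : ℕ), g = ShiftedHom.mk₀ j hj (f ^ n : End X) := by
  induction hg with
  | self => exact ⟨rfl, 1, by rw [pow_one]⟩
  | comp e _ _ h₁ h₂ =>
    obtain ⟨hj, m, rfl⟩ := h₁
    obtain ⟨hk, n, rfl⟩ := h₂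
    refine ⟨by omega, n + m, ?_⟩
    rw [ShiftedHom.mk₀_comp_mk₀, pow_add]
    rfl

namespace Spc

lemma unit_notMem (P : Spc K) : ¬ P.mem (𝟙_ K) := fun h =>
  P.exists_notMem.elim fun a ha => ha (P.mem.prop_of_iso (ρ_ a) (P.tensor_left a h))

variable {P : Spc K}

lemma trW_comp_iff_of_balanced {X : K} (hX : ¬ P.mem X) {f g : X ⟶ X} (hf : f ▷ X = X ◁ f)
    (hg : g ▷ X = X ◁ g) : P.mem.trW (f ≫ g) ↔ P.mem.trW f ∧ P.mem.trW g := by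
  have h := trW_comp_iff hX (balanced_mk₀ hf) (balanced_mk₀ hg) (add_zero 0)
  rwa [ShiftedHom.mk₀_comp_mk₀, trW_mk₀_iff, trW_mk₀_iff, trW_mk₀_iff] at h

lemma trW_or_trW_of_add_of_balanced {X : K} (hX : ¬ P.mem X) {f g : X ⟶ X} (hf : f ▷ X = X ◁ f)
    (hg : g ▷ X = X ◁ g) (h : P.mem.trW (f + g)) : P.mem.trW f ∨ P.mem.trW g := by
  rw [← trW_mk₀_iff, ShiftedHom.mk₀_add] at h
  simpa only [trW_mk₀_iff] using trW_or_trW_of_add hX (balanced_mk₀ hf) (balanced_mk₀ hg) h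

/-- If no power of a tensor-balanced endomorphism `f` vanishes on an object of `Φ`, then there is a
prime that contains the cone of `f` and no object of `Φ`. -/
lemma exists_trW_of_pow_ne_zero {X : K} {f : End X} (hf : (f : X ⟶ X) ▷ X = X ◁ (f : X ⟶ X))
    (Φ : TensorMultSet K)
    (hΦ : ∀ n : ℕ, ∀ Y ∈ Φ.carrier, ((f ^ n : End X) : X ⟶ X) ▷ Y ≠ 0) :
    ∃ P : Spc K, P.mem.trW (f : X ⟶ X) ∧ ∀ Y ∈ Φ.carrier, ¬ P.mem Y := by
  obtain ⟨P, hP, hPΦ⟩ := (balanced_mk₀ hf).exists_prime Φ (fun g hg Y hY h => by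
    obtain ⟨hj, n, rfl⟩ := hg.exists_pow
    refine hΦ n Y hY ?_
    rw [ShiftedHom.mk₀, comp_whiskerRight] at h
    simpa using h)
  exact ⟨P, (trW_mk₀_iff _).1 ((trW_iff_cone _ _).2 hP), hPΦ⟩

lemma isClosed_zeroLocus (S : Set K) : IsClosed (zeroLocus S) :=
  ⟨⟨S, (compl_compl _).symm⟩⟩

end Spc

lemma notMem_of_mem_suppSet {Φ : TensorMultSet K} {P : Spc K} (hP : P ∈ suppSet Φ) {X : K}
    (hX : X ∈ Φ.carrier) : ¬ P.mem X :=
  Set.mem_iInter₂.1 hP X hX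

lemma mem_suppSet {Φ : TensorMultSet K} {P : Spc K} (h : ∀ Y ∈ Φ.carrier, ¬ P.mem Y) :
    P ∈ suppSet Φ :=
  Set.mem_iInter₂.2 h

variable {Φ : TensorMultSet K}

/-- `rhoSet` asks for some representative with cone outside `P`; for `P ∈ Z_Φ` any given
representative decides. -/
lemma mk_mem_rhoSet_iff {P : Spc K} (hP : P ∈ suppSet Φ) {X : K} (hX : X ∈ Φ.carrier)
    (f : balancedEnd X) : R.mk hX f ∈ rhoSet Φ P ↔ ¬ P.mem.trW (f.1 : X ⟶ X) := by
  constructor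
  · rintro ⟨Y, hY, g, hfg, hg⟩
    rw [← trW_iff_cone P.mem] at hg
    refine (BalancedSystem.iff_of_cls_eq (S := balancedEndSystem K)
      (fun X (f : balancedEnd X) => ¬ P.mem.trW (f.1 : X ⟶ X)) ?_ ?_ hfg).2 hg
    · exact fun ha _ f => not_congr (Spc.trW_whiskerLeft_iff (notMem_of_mem_suppSet hP ha) _)
    · exact fun ha _ f => not_congr (Spc.trW_whiskerRight_iff (notMem_of_mem_suppSet hP ha) _)
  · intro h
    rw [trW_iff_cone P.mem] at h
    exact ⟨X, hX, f, rfl, h⟩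

/-- The comparison map `ρ_Φ`. -/
noncomputable def rho (Φ : TensorMultSet K) (P : suppSet Φ) : PrimeSpectrum (R Φ) where
  asIdeal :=
    { carrier := rhoSet Φ P.1
      zero_mem' := by
        obtain ⟨X, hX⟩ := Φ.nonempty
        rw [R.zero_eq hX, mk_mem_rhoSet_iff P.2]
        exact fun h => notMem_of_mem_suppSet P.2 hX (prop_of_trW_zero _ h)
      add_mem' := fun {x y} hx hy => by
        obtain ⟨X, hX, f, g, rfl, rfl⟩ := R.exists_rep₂ x y
        rw [mk_mem_rhoSet_iff P.2] at hx hy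
        rw [R.mk_add, mk_mem_rhoSet_iff P.2]
        exact fun h => (Spc.trW_or_trW_of_add_of_balanced (notMem_of_mem_suppSet P.2 hX)
          f.2 g.2 h).elim hx hy
      smul_mem' := fun x y hy => by
        obtain ⟨X, hX, f, g, rfl, rfl⟩ := R.exists_rep₂ x y
        rw [mk_mem_rhoSet_iff P.2] at hy
        rw [smul_eq_mul, R.mk_mul, mk_mem_rhoSet_iff P.2]
        -- The product `f * g` is `g ≫ f`, so the factor from the ideal comes first.
        exact fun h => hy ((Spc.trW_comp_iff_of_balanced (notMem_of_mem_suppSet P.2 hX)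
          g.2 f.2).1 h).1 }
  isPrime := by
    constructor
    · rw [Ideal.ne_top_iff_one]
      obtain ⟨X, hX⟩ := Φ.nonempty
      change (1 : R Φ) ∉ rhoSet Φ P.1
      rw [R.one_eq hX, mk_mem_rhoSet_iff P.2, not_not]
      exact P.1.mem.trW_of_isIso (𝟙 X)
    · intro x y
      change x * y ∈ rhoSet Φ P.1 → x ∈ rhoSet Φ P.1 ∨ y ∈ rhoSet Φ P.1
      obtain ⟨X, hX, f, g, rfl, rfl⟩ := R.exists_rep₂ x y
      rw [R.mk_mul, mk_mem_rhoSet_iff P.2, mk_mem_rhoSet_iff P.2, mk_mem_rhoSet_iff P.2,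
        ← not_and_or, not_imp_not]
      exact fun h => (Spc.trW_comp_iff_of_balanced (notMem_of_mem_suppSet P.2 hX) g.2 f.2).2 h.symm

lemma mk_mem_rho_iff (P : suppSet Φ) {X : K} (hX : X ∈ Φ.carrier) (f : balancedEnd X) :
    R.mk hX f ∈ (rho Φ P).asIdeal ↔ ¬ P.1.mem (cone (f.1 : X ⟶ X)) := by
  rw [← trW_iff_cone P.1.mem]
  exact mk_mem_rhoSet_iff P.2 hX f

/-- The preimage of `V(s)` is the trace on `Z_Φ` of the closed set defined by the cones of all
representatives of elements of `s`. -/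
lemma continuous_rho : Continuous (rho Φ) := by
  refine continuous_iff_isClosed.2 fun W hW => ?_
  obtain ⟨s, rfl⟩ := (PrimeSpectrum.isClosed_iff_zeroLocus W).1 hW
  have h : rho Φ ⁻¹' PrimeSpectrum.zeroLocus s = Subtype.val ⁻¹' Spc.zeroLocus
      {a | ∃ (X : K) (hX : X ∈ Φ.carrier) (f : balancedEnd X), R.mk hX f ∈ s ∧
        a = cone (f.1 : X ⟶ X)} := by
    ext P
    constructor
    · rintro h _ ⟨X, hX, f, hf, rfl⟩
      exact (mk_mem_rho_iff P hX f).1 (h hf)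
    · intro h x hx
      obtain ⟨X, hX, f, rfl⟩ := x.exists_rep
      exact (mk_mem_rho_iff P hX f).2 (h _ ⟨X, hX, f, hx, rfl⟩)
  rw [h]
  exact (Spc.isClosed_zeroLocus _).preimage continuous_subtype_val

lemma R.mk_pow {X : K} (hX : X ∈ Φ.carrier) (f : balancedEnd X) (n : ℕ) :
    mk hX f ^ n = mk hX (f ^ n) := by
  induction n with
  | zero => rw [pow_zero, pow_zero, one_eq hX]
  | succ n ih => rw [pow_succ, pow_succ, ih, mk_mul]

lemma rho_preimage_ne_univ {W : Set (PrimeSpectrum (R Φ))} (hW : IsClosed W)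
    (hne : W ≠ Set.univ) : rho Φ ⁻¹' W ≠ Set.univ := by
  obtain ⟨s, rfl⟩ := (PrimeSpectrum.isClosed_iff_zeroLocus W).1 hW
  obtain ⟨p, hp⟩ := (Set.ne_univ_iff_exists_notMem _).1 hne
  obtain ⟨x, hxs, hxp⟩ := Set.not_subset.1 hp
  obtain ⟨X, hX, f, rfl⟩ := x.exists_rep
  -- If `f ^ n` vanished on some `Y ∈ Φ`, then `[f] ^ n = [f ^ n ⊗ Y] = 0`, and `[f]` would lie in
  -- the prime `p`.
  obtain ⟨P, hfP, hP⟩ := Spc.exists_trW_of_pow_ne_zero f.2 Φ (fun n Y hY h => by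
    have hz : (balancedEndSystem K).right Y (f ^ n) = (0 : balancedEnd (X ⊗ Y)) :=
      Subtype.ext h
    have h0 : R.mk hX f ^ n = 0 := by
      rw [R.mk_pow, R.zero_eq (Φ.tensor_mem hX hY), ← hz]
      exact (BalancedSystem.cls_right hY hX _).symm
    exact hxp (p.isPrime.mem_of_pow_mem n (h0 ▸ p.asIdeal.zero_mem)))
  refine (Set.ne_univ_iff_exists_notMem _).2 ⟨⟨P, mem_suppSet hP⟩, fun h => ?_⟩
  exact (mk_mem_rhoSet_iff (mem_suppSet hP) hX f).1 (h hxs) hfP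

/-- The left and right unitors of the unit coincide, so both sides are the same conjugate of `f`. -/
lemma unit_balanced (f : 𝟙_ K ⟶ 𝟙_ K) : f ▷ 𝟙_ K = 𝟙_ K ◁ f := by
  simp [unitors_equal, unitors_inv_equal]

/-- Balmer's comparison map `ρ_𝟙`. -/
noncomputable def unitRho (P : Spc K) : PrimeSpectrum (End (𝟙_ K)) where
  asIdeal :=
    { carrier := unitRhoSet P
      zero_mem' := fun h => P.unit_notMem (prop_of_trW_zero _ ((trW_iff_cone P.mem _).2 h))
      add_mem' := fun {f g} hf hg h => by
        rw [← trW_iff_cone P.mem] at h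
        have := Spc.trW_or_trW_of_add_of_balanced P.unit_notMem (unit_balanced f)
          (unit_balanced g) h
        rw [trW_iff_cone, trW_iff_cone] at this
        exact this.elim hf hg
      smul_mem' := fun f g hg h => by
        rw [← trW_iff_cone P.mem] at h
        have := (Spc.trW_comp_iff_of_balanced P.unit_notMem (unit_balanced g)
          (unit_balanced f)).1 h
        exact hg ((trW_iff_cone _ _).1 this.1) }
  isPrime := by
    constructor
    · rw [Ideal.ne_top_iff_one]
      exact fun h => h ((trW_iff_cone P.mem _).1 (P.mem.trW_of_isIso (𝟙 (𝟙_ K))))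
    · intro f g hfg
      by_contra! hc
      refine hfg ((trW_iff_cone P.mem _).1 ?_)
      refine (Spc.trW_comp_iff_of_balanced P.unit_notMem (unit_balanced g)
        (unit_balanced f)).2 ⟨(trW_iff_cone _ _).2 (not_not.1 hc.2),
          (trW_iff_cone _ _).2 (not_not.1 hc.1)⟩

/-- The objects that are isomorphic to the unit. -/
def unitMultSet (K : Type u) [Category.{v} K] [MonoidalCategory K] : TensorMultSet K where
  carrier := {X | Nonempty (X ≅ 𝟙_ K)}
  nonempty := ⟨𝟙_ K, ⟨Iso.refl _⟩⟩
  tensor_mem := fun ⟨e⟩ ⟨e'⟩ => ⟨tensorIso e e' ≪≫ λ_ _⟩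

lemma denseRange_unitRho : DenseRange (unitRho (K := K)) := by
  refine denseRange_of_preimage_ne_univ fun W hW hne => ?_
  obtain ⟨s, rfl⟩ := (PrimeSpectrum.isClosed_iff_zeroLocus W).1 hW
  obtain ⟨p, hp⟩ := (Set.ne_univ_iff_exists_notMem _).1 hne
  obtain ⟨f, hfs, hfp⟩ := Set.not_subset.1 hp
  -- `{𝟙}` need not be closed under `⊗` on the nose, hence its isomorphism class. Vanishing of `f ^
  -- n` on an object isomorphic to the unit means `f ^ n = 0`.
  obtain ⟨P, hfP, -⟩ := Spc.exists_trW_of_pow_ne_zero (unit_balanced f) (unitMultSet K)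
    (fun n Y ⟨e⟩ h => by
      have h0 : f ^ n = 0 := by
        have := whiskerRight_eq_zero_of_retract (Retract.ofIso e.symm) h
        simpa using this
      exact hfp (p.isPrime.mem_of_pow_mem n (h0 ▸ p.asIdeal.zero_mem)))
  refine (Set.ne_univ_iff_exists_notMem _).2 ⟨P, fun h => ?_⟩
  exact h hfs ((trW_iff_cone _ _).1 hfP)

end Ungraded

/-! ### The graded comparison map -/

section Graded

variable {K : Type u} [Category.{v} K] [HasZeroObject K] [HasShift K ℤ]
  [Preadditive K] [∀ n : ℤ, (shiftFunctor K n).Additive] [Pretriangulated K]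
  [IsTriangulated K] [MonoidalCategory K] [SymmetricCategory K] [TensorTriangulated K]
  {Φ : TensorMultSet K}

lemma mk_mem_gradedRhoSet_iff {P : Spc K} (hP : P ∈ suppSet Φ) {X : K} (hX : X ∈ Φ.carrier)
    {i : ℤ} (f : gradedEnd X i) : GR.mk hX f ∈ gradedRhoSet Φ P i ↔ ¬ P.mem.trW f.1 := by
  constructor
  · rintro ⟨Y, hY, g, hfg, hg⟩
    rw [← trW_iff_cone P.mem] at hg
    refine (BalancedSystem.iff_of_cls_eq (S := gradedEndSystem K i)
      (fun X (f : gradedEnd X i) => ¬ P.mem.trW f.1) ?_ ?_ hfg).2 hg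
    · exact fun ha _ f => not_congr (Spc.trW_map_tensorLeft_iff (notMem_of_mem_suppSet hP ha) _)
    · exact fun ha _ f => not_congr (Spc.trW_map_tensorRight_iff (notMem_of_mem_suppSet hP ha) _)
  · intro h
    rw [trW_iff_cone P.mem] at h
    exact ⟨X, hX, f, rfl, h⟩

/-- One equivalence yields both ideal properties and primality of `ρ_Φ^•(P)`. -/
lemma gmul_mem_gradedRhoSet_iff {P : Spc K} (hP : P ∈ suppSet Φ) {i j : ℤ} (x : GR Φ i)
    (y : GR Φ j) : (GradedMonoid.GMul.mul x y : GR Φ (i + j)) ∈ gradedRhoSet Φ P (i + j) ↔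
      x ∈ gradedRhoSet Φ P i ∨ y ∈ gradedRhoSet Φ P j := by
  obtain ⟨X, hX, f, g, rfl, rfl⟩ := GR.exists_rep₂ x y
  rw [GR.mk_gmul, mk_mem_gradedRhoSet_iff hP, mk_mem_gradedRhoSet_iff hP,
    mk_mem_gradedRhoSet_iff hP, ← not_and_or, and_comm]
  exact not_congr (Spc.trW_comp_iff (notMem_of_mem_suppSet hP hX) g.2 f.2 rfl)

/-- The graded comparison map `ρ_Φ^•`. -/
noncomputable def gradedRho (Φ : TensorMultSet K) (P : suppSet Φ) : HomogSpec (GR Φ) where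
  part i :=
    { carrier := gradedRhoSet Φ P.1 i
      zero_mem' := by
        obtain ⟨X, hX⟩ := Φ.nonempty
        rw [GR.zero_eq hX, mk_mem_gradedRhoSet_iff P.2]
        exact Spc.not_trW_zero (notMem_of_mem_suppSet P.2 hX) i
      add_mem' := fun {x y} hx hy => by
        obtain ⟨X, hX, f, g, rfl, rfl⟩ := GR.exists_rep₂ x y
        rw [mk_mem_gradedRhoSet_iff P.2] at hx hy
        rw [GR.mk_add, mk_mem_gradedRhoSet_iff P.2]
        exact fun h => (Spc.trW_or_trW_of_add (notMem_of_mem_suppSet P.2 hX)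
          f.2 g.2 h).elim hx hy
      neg_mem' := fun {x} hx => by
        obtain ⟨X, hX, f, rfl⟩ := x.exists_rep
        rw [mk_mem_gradedRhoSet_iff P.2] at hx
        rw [GR.mk_neg, mk_mem_gradedRhoSet_iff P.2]
        exact fun h => hx ((P.1.trW_neg_iff _).1 h) }
  mul_mem_left x _ hy := (gmul_mem_gradedRhoSet_iff P.2 x _).2 (.inr hy)
  mul_mem_right y hx := (gmul_mem_gradedRhoSet_iff P.2 _ y).2 (.inl hx)
  one_notMem := by
    obtain ⟨X, hX⟩ := Φ.nonempty
    change GR.one ∉ gradedRhoSet Φ P.1 0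
    rw [GR.one_eq hX, mk_mem_gradedRhoSet_iff P.2, not_not]
    exact Spc.trW_mk₀_iff _ |>.2 (P.1.mem.trW_of_isIso (𝟙 X))
  mem_or_mem h := (gmul_mem_gradedRhoSet_iff P.2 _ _).1 h

lemma mk_mem_gradedRho_iff (P : suppSet Φ) {X : K} (hX : X ∈ Φ.carrier) {i : ℤ}
    (f : gradedEnd X i) :
    GR.mk hX f ∈ (gradedRho Φ P).part i ↔ ¬ P.1.mem (cone (f.1 : X ⟶ X⟦i⟧)) := by
  rw [← trW_iff_cone P.1.mem]
  exact mk_mem_gradedRhoSet_iff P.2 hX f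

lemma HomogSpec.isClosed_iff_zeroLocus {A : ℤ → Type u} [∀ i, AddCommGroup (A i)]
    [DirectSum.GRing A] {W : Set (HomogSpec A)} :
    IsClosed W ↔ ∃ S, zeroLocus S = W := by
  rw [← isOpen_compl_iff]
  change Wᶜᶜ ∈ Set.range zeroLocus ↔ _
  rw [compl_compl]
  rfl

lemma continuous_gradedRho : Continuous (gradedRho Φ) := by
  refine continuous_iff_isClosed.2 fun W hW => ?_
  obtain ⟨S, rfl⟩ := HomogSpec.isClosed_iff_zeroLocus.1 hW
  have h : gradedRho Φ ⁻¹' HomogSpec.zeroLocus S = Subtype.val ⁻¹' Spc.zeroLocus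
      {a | ∃ (i : ℤ) (X : K) (hX : X ∈ Φ.carrier) (f : gradedEnd X i), ⟨i, GR.mk hX f⟩ ∈ S ∧
        a = cone (f.1 : X ⟶ X⟦i⟧)} := by
    ext P
    constructor
    · rintro h _ ⟨i, X, hX, f, hf, rfl⟩
      exact (mk_mem_gradedRho_iff P hX f).1 (h _ hf)
    · rintro h ⟨i, x⟩ hx
      obtain ⟨X, hX, f, rfl⟩ := x.exists_rep
      exact (mk_mem_gradedRho_iff P hX f).2 (h _ ⟨i, X, hX, f, hx, rfl⟩)
  rw [h]
  exact (Spc.isClosed_zeroLocus _).preimage continuous_subtype_val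

/-- The homogeneous counterpart of `Ideal.IsPrime.mem_of_pow_mem`, by induction on how the power is
built. -/
lemma mk_mem_of_isPower (p : HomogSpec (GR Φ)) {X : K} (hX : X ∈ Φ.carrier) {i j : ℤ}
    (f : gradedEnd X i) {g : ShiftedHom X X j} (hg : IsPower f.1 g) (hg' : g ∈ gradedEnd X j)
    (hgp : GR.mk hX (⟨g, hg'⟩ : gradedEnd X j) ∈ p.part j) : GR.mk hX f ∈ p.part i := by
  induction hg with
  | self => exact hgp
  | @comp j k l g h e hg hh ihg ihh =>
    -- The degree becomes literally `k + j`, the degree in which `GMul.mul` takes its value. The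
    -- factors appear reversed, since `g.comp h` is the product `h ∘ g`.
    subst e
    have hgb : g ∈ gradedEnd X j := hg.balanced f.2
    have hhb : h ∈ gradedEnd X k := hh.balanced f.2
    have hmul : GR.mk hX (⟨g.comp h rfl, hg'⟩ : gradedEnd X (k + j)) = GradedMonoid.GMul.mul
        (GR.mk hX (⟨h, hhb⟩ : gradedEnd X k)) (GR.mk hX (⟨g, hgb⟩ : gradedEnd X j)) :=
      (GR.mk_gmul hX (⟨h, hhb⟩ : gradedEnd X k) (⟨g, hgb⟩ : gradedEnd X j)).symm
    rw [hmul] at hgp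
    exact (p.mem_or_mem hgp).elim (ihh hhb) (ihg hgb)

lemma gradedRho_preimage_ne_univ {W : Set (HomogSpec (GR Φ))} (hW : IsClosed W)
    (hne : W ≠ Set.univ) : gradedRho Φ ⁻¹' W ≠ Set.univ := by
  obtain ⟨S, rfl⟩ := HomogSpec.isClosed_iff_zeroLocus.1 hW
  obtain ⟨p, hp⟩ := (Set.ne_univ_iff_exists_notMem _).1 hne
  obtain ⟨⟨i, x⟩, hxS, hxp⟩ : ∃ x ∈ S, x.2 ∉ p.part x.1 := by
    simpa [HomogSpec.zeroLocus] using hp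
  obtain ⟨X, hX, f, rfl⟩ := x.exists_rep
  have hf : Balanced f.1 := f.2
  obtain ⟨P, hfP, hP⟩ := hf.exists_prime Φ (fun {j} g hg Y hY h => by
    have hgb : g ∈ gradedEnd X j := hg.balanced hf
    have hz : (gradedEndSystem K j).right Y (⟨g, hgb⟩ : gradedEnd X j) =
        (0 : gradedEnd (X ⊗ Y) j) :=
      Subtype.ext (by
        change g ▷ Y ≫ _ = 0
        rw [h, zero_comp])
    have h0 : GR.mk hX (⟨g, hgb⟩ : gradedEnd X j) = 0 := by
      rw [GR.zero_eq (Φ.tensor_mem hX hY), ← hz]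
      exact (BalancedSystem.cls_right hY hX _).symm
    exact hxp (mk_mem_of_isPower p hX f hg hgb (h0 ▸ (p.part j).zero_mem)))
  refine (Set.ne_univ_iff_exists_notMem _).2 ⟨⟨P, mem_suppSet hP⟩, fun h => ?_⟩
  exact (mk_mem_gradedRho_iff ⟨P, mem_suppSet hP⟩ hX f).1 (h _ hxS) hfP

end Graded

end TTG

theorem mainTheorem9 {K : Type u} [Category.{v} K] [HasZeroObject K] [HasShift K ℤ]
    [Preadditive K] [∀ n : ℤ, (shiftFunctor K n).Additive] [Pretriangulated K]
    [IsTriangulated K] [MonoidalCategory K] [SymmetricCategory K] [TTG.TensorTriangulated K]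
    (Φ : TTG.TensorMultSet K) :
    -- the ungraded comparison map of `Φ`
    (∃ rho : TTG.suppSet Φ → PrimeSpectrum (TTG.R Φ),
      (∀ P, ((rho P).asIdeal : Set (TTG.R Φ)) = TTG.rhoSet Φ P.1) ∧
      (∀ W : Set (PrimeSpectrum (TTG.R Φ)), IsClosed W → W ≠ Set.univ →
        rho ⁻¹' W ≠ Set.univ) ∧
      DenseRange rho ∧
      (IrreducibleSpace (TTG.suppSet Φ) → IrreducibleSpace (PrimeSpectrum (TTG.R Φ)))) ∧
    -- the graded comparison map of `Φ`
    (∃ rho : TTG.suppSet Φ → TTG.HomogSpec (TTG.GR Φ),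
      (∀ P i, ((rho P).part i : Set (TTG.GR Φ i)) = TTG.gradedRhoSet Φ P.1 i) ∧
      (∀ W : Set (TTG.HomogSpec (TTG.GR Φ)), IsClosed W → W ≠ Set.univ →
        rho ⁻¹' W ≠ Set.univ) ∧
      DenseRange rho ∧
      (IrreducibleSpace (TTG.suppSet Φ) → IrreducibleSpace (TTG.HomogSpec (TTG.GR Φ)))) ∧
    -- Balmer's comparison map of the unit object
    (∃ rho : TTG.Spc K → PrimeSpectrum (End (𝟙_ K)),
      (∀ P, ((rho P).asIdeal : Set (End (𝟙_ K))) = TTG.unitRhoSet P) ∧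
      DenseRange rho) := by
  refine ⟨⟨TTG.rho Φ, fun _ => rfl, fun _ => TTG.rho_preimage_ne_univ,
      TTG.denseRange_of_preimage_ne_univ fun _ => TTG.rho_preimage_ne_univ, fun _ => ?_⟩,
    ⟨TTG.gradedRho Φ, fun _ _ => rfl, fun _ => TTG.gradedRho_preimage_ne_univ,
      TTG.denseRange_of_preimage_ne_univ fun _ => TTG.gradedRho_preimage_ne_univ, fun _ => ?_⟩,
    ⟨TTG.unitRho, fun _ => rfl, TTG.denseRange_unitRho⟩⟩
  · exact TTG.irreducibleSpace_of_denseRange TTG.continuous_rho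
      (TTG.denseRange_of_preimage_ne_univ fun _ => TTG.rho_preimage_ne_univ)
  · exact TTG.irreducibleSpace_of_denseRange TTG.continuous_gradedRho
      (TTG.denseRange_of_preimage_ne_univ fun _ => TTG.gradedRho_preimage_ne_univ)
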